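/- Consider Hoare's Quickselect (FIND) with the following partitioning procedure. A list $A[1..n]$ of $n\ge 2$ distinct keys is partitioned with pivot $p=A[1]$: starting from $i=0$ and $j=n+1$, repeat: decrease $j$ (at least once) until $A[j]\le p$, then increase $i$ (at least once) until $A[i]\ge p$; if $i<j$, exchange $A[i]$ and $A[j]$ (one key exchange) and continue, otherwise stop. The left sub-list is then $A[1..j]$, the right sub-list is $A[j+1..n]$, and the algorithm is applied recursively to the sub-list that contains the key of the rank to be selected, until a list of size one is reached. Let $Y_n$ be the total number of key exchanges made when the algorithm acts on a uniformly random permutation of size $n\ge1$ and the rank to be selected is uniformly distributed on $\{1,\dots,n\}$ and independent of the permutation. Then, as $n\to\infty$, $$\frac{Y_n}{n}\stackrel{d}{\longrightarrow}X,$$ where the distribution of $X$ is the unique solution, among all probability distributions on $\mathbb R$, of the recursive distributional equation $$X\stackrel{d}{=}\sqrt U\,X+\sqrt U\,(1-\sqrt U),$$ with $U$ uniformly distributed on $[0,1]$ and independent of the $X$ on the right-hand side. Moreover, $\operatorname{Var}(Y_n)\sim \frac1{60}n^2$ as $n\to\infty$. -/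

import Mathlib

open Filter Topology MeasureTheory ProbabilityTheory

/-! ### The algorithm

An array of length `n` is a function `A : ℕ → ℕ` of which only the entries
`A 0, …, A (n - 1)` matter; positions are counted from `0`, ranks from `1`. -/

/-- Right-to-left scan: starting at position `j`, move the right pointer down until an entry
`A j ≤ x` is found. -/
def scanDown (A : ℕ → ℕ) (x : ℕ) : ℕ → ℕ
  | 0 => 0
  | j + 1 => if A (j + 1) ≤ x then j + 1 else scanDown A x j

/-- Left-to-right scan: starting at position `i`, move the left pointer up until an entry
`x ≤ A i` is found. (In the algorithm such an entry always exists below position `n`,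
so the bound `n` is never reached.) -/
def scanUp (A : ℕ → ℕ) (n x i : ℕ) : ℕ :=
  if i < n ∧ A i < x then scanUp A n x (i + 1) else i
termination_by n - i

theorem scanDown_le (A : ℕ → ℕ) (x j : ℕ) : scanDown A x j ≤ j := by
  induction j with
  | zero => simp [scanDown]
  | succ j ih =>
    unfold scanDown
    split_ifs
    · exact le_rfl
    · omega

/-- The result of a call to the partitioning procedure. -/
structure PartitionResult where
  /-- the rearranged array -/
  array : ℕ → ℕ
  /-- the size of the left sub-list -/
  leftSize : ℕ
  /-- the number of key exchanges -/
  exchanges : ℕ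

/-- The main loop of Hoare's partitioning procedure with pivot `x`, where the scans start at
the positions `i` (from the left) and `j` (from the right), and `t` key exchanges have already
been made. If the pointers `i'`, `j'` stop with `i' < j'`, the entries there are exchanged and
the scans go on strictly between them; otherwise the left sub-list ends at position `j'`. -/
def hoareLoop (n x : ℕ) (A : ℕ → ℕ) (i j t : ℕ) : PartitionResult :=
  let j' := scanDown A x j
  let i' := scanUp A n x i
  if i' < j' then hoareLoop n x (A ∘ Equiv.swap i' j') (i' + 1) (j' - 1) (t + 1)
  else ⟨A, j' + 1, t⟩
termination_by j
decreasing_by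
  have := scanDown_le A x j
  omega

/-- Hoare's partitioning procedure on the array `A 0, …, A (n - 1)`, with the first entry as
pivot. -/
def hoarePartition (A : ℕ → ℕ) (n : ℕ) : PartitionResult :=
  hoareLoop n (A 0) A 0 (n - 1) 0

theorem hoareLoop_leftSize_pos (n x : ℕ) (A : ℕ → ℕ) (i j t : ℕ) :
    0 < (hoareLoop n x A i j t).leftSize := by
  fun_induction hoareLoop n x A i j t with
  | case1 => assumption
  | case2 => exact Nat.succ_pos _

theorem hoareLoop_leftSize_le (n x : ℕ) (A : ℕ → ℕ) (i j t : ℕ) :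
    (hoareLoop n x A i j t).leftSize ≤ j + 1 := by
  fun_induction hoareLoop n x A i j t with
  | case1 A i j t j' i' h ih =>
    have : j' ≤ j := scanDown_le A x j
    omega
  | case2 A i j t j' i' h =>
    have : j' ≤ j := scanDown_le A x j
    show j' + 1 ≤ j + 1
    omega

theorem hoarePartition_leftSize_pos (A : ℕ → ℕ) (n : ℕ) :
    0 < (hoarePartition A n).leftSize :=
  hoareLoop_leftSize_pos _ _ _ _ _ _

theorem hoarePartition_leftSize_lt (A : ℕ → ℕ) {n : ℕ} (hn : 2 ≤ n) :
    (hoarePartition A n).leftSize < n := by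
  have h0 : scanUp A n (A 0) 0 = 0 := by
    unfold scanUp
    simp
  have h1 := scanDown_le A (A 0) (n - 1)
  unfold hoarePartition hoareLoop
  simp only [h0]
  split_ifs with h
  · have := hoareLoop_leftSize_le n (A 0) (A ∘ Equiv.swap 0 (scanDown A (A 0) (n - 1)))
      (0 + 1) (scanDown A (A 0) (n - 1) - 1) (0 + 1)
    omega
  · show scanDown A (A 0) (n - 1) + 1 < n
    omega

/-- The number of key exchanges made by Hoare's Quickselect when it selects the element of
rank `r` (where `1 ≤ r ≤ n`) from the array `A 0, …, A (n - 1)`: nothing is done on a list of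
size one; otherwise the array is partitioned and the algorithm goes on with the sub-list that
contains the element to be selected. -/
def quickselectExchanges (A : ℕ → ℕ) (n r : ℕ) : ℕ :=
  if n ≤ 1 then 0
  else
    let P := hoarePartition A n
    P.exchanges +
      if r ≤ P.leftSize then quickselectExchanges P.array P.leftSize r
      else quickselectExchanges (fun k => P.array (P.leftSize + k)) (n - P.leftSize)
        (r - P.leftSize)
termination_by n
decreasing_by
  · exact hoarePartition_leftSize_lt A (by omega)
  · have := hoarePartition_leftSize_pos A n
    omega

/-! ### The probabilistic model -/

/-- The array whose entry at position `i < n` is `σ i`. -/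
def permArray {n : ℕ} (σ : Equiv.Perm (Fin n)) : ℕ → ℕ :=
  fun k => if h : k < n then (σ ⟨k, h⟩ : ℕ) else 0

/-- Every set of permutations is an event. -/
instance permMeasurableSpace (n : ℕ) : MeasurableSpace (Equiv.Perm (Fin n)) := ⊤

/-- A uniformly random permutation of size `n` and an independent uniform rank
(for `n ≥ 1`; the zero measure on the empty space if `n = 0`). -/
noncomputable def selectMeasure (n : ℕ) : Measure (Equiv.Perm (Fin n) × Fin n) :=
  (uniformOn (Set.univ : Set (Equiv.Perm (Fin n)))).prod (uniformOn (Set.univ : Set (Fin n)))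

instance selectMeasure_isProbabilityMeasure (n : ℕ) :
    IsProbabilityMeasure (selectMeasure (n + 1)) := by
  unfold selectMeasure
  infer_instance

/-- The random variable `Y_n`: the number of key exchanges of Quickselect on the random
permutation `σ` when the element of the random rank `r + 1 ∈ {1, …, n}` is selected. -/
def keyExchanges (n : ℕ) (ω : Equiv.Perm (Fin n) × Fin n) : ℕ :=
  quickselectExchanges (permArray ω.1) n (ω.2 + 1)

/-! ### The recursive distributional equation -/

/-- The law `ν` on `ℝ` satisfies `X =_d √U X + √U (1 - √U)`, where `X` has law `ν` and is
independent of `U`, which is uniform on `[0, 1]`. -/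
def IsRDESolution (ν : Measure ℝ) : Prop :=
  (ν.prod (volume.restrict (Set.Icc (0 : ℝ) 1))).map
    (fun p : ℝ × ℝ => √p.2 * p.1 + √p.2 * (1 - √p.2)) = ν

/-!
A partition with a pivot of rank `k` (counted from zero, `k ≥ 1`) of a list of size `m` leaves
lists of sizes `k` and `m - k`, and makes as many exchanges as there are keys smaller than the
pivot outside the first `k` positions (`hoarePartition_spec`), which is close to `k (m - k) / m`.
As the list that contains the selected key is chosen with probability proportional to its size,
its relative size is asymptotically `√U`, and the number of exchanges divided by `m` is
asymptotically `√U (1 - √U)`. This is where the distributional equation comes from.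

The sub-lists are not uniformly random: the pivot is the smallest key of the right sub-list, and
its position there is biased towards the end. However, the class of random lists whose law is
invariant under all permutations of the keys that fix the smallest key (`IsMinExchangeable`)
contains the uniformly random lists and is preserved by the partition, because the procedure
commutes with relabellings of the keys that respect the order relative to the pivot. Within this
class the pivot is uniform among the keys other than the smallest one (`pivot_weight`), and the
number of exchanges is concentrated (`sum_abs_exchanges_sub_le`).

For these lists `DistanceBound` bounds the distance between the number of exchanges and `m X`,
tested against 1-Lipschitz functions, by a multiple of `√m`, by induction on `m`
(`distanceBound`): the errors of one step are `O(√m)`, and the average of `√k` over the size-biased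
size `k` of the remaining list is at most `49 / 60 * √m` (`sum_mul_sqrt_le`), so that the induction
closes. The only obstacle is the case that the smallest key comes first, when the size decreases
just by one; it is dealt with by a penalty term proportional to its probability, which is small
after one such step.

A solution of the equation supported in `[0, 1]` is the law of the perpetuity
`∑ V₀ ⋯ Vₖ (1 - Vₖ)` with independent `Vₖ` distributed like `√U`. It is unique because the
difference of the characteristic functions of two solutions is dominated by its own averages over
smaller arguments. Convergence in distribution follows from the distance bound with Lipschitz test
functions, and so does the asymptotic variance, since the number of exchanges never exceeds the
number of keys and the first two moments of the solution are `1 / 2` and `4 / 15`.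
-/

/-! ### Hoare's partitioning procedure -/

theorem lt_of_scanDown_lt (A : ℕ → ℕ) (x : ℕ) {j q : ℕ} (h : scanDown A x j < q) (hq : q ≤ j) :
    x < A q := by
  induction j with
  | zero => omega
  | succ j ih =>
    unfold scanDown at h
    split_ifs at h with h1
    · omega
    · rcases Nat.lt_or_ge j q with h2 | h2
      · obtain rfl : q = j + 1 := by omega
        omega
      · exact ih h h2

theorem apply_scanDown_le (A : ℕ → ℕ) (x : ℕ) {j q : ℕ} (hq : q ≤ j) (h : A q ≤ x) :
    A (scanDown A x j) ≤ x := by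
  induction j with
  | zero =>
    obtain rfl : q = 0 := by omega
    simpa [scanDown] using h
  | succ j ih =>
    unfold scanDown
    split_ifs with h1
    · exact h1
    · refine ih ?_
      rcases Nat.lt_or_ge j q with h2 | h2
      · obtain rfl : q = j + 1 := by omega
        exact absurd h h1
      · exact h2

theorem le_scanUp (A : ℕ → ℕ) (n x i : ℕ) : i ≤ scanUp A n x i := by
  fun_induction scanUp A n x i with
  | case1 => omega
  | case2 => exact le_rfl

theorem lt_of_lt_scanUp (A : ℕ → ℕ) (n x i : ℕ) {q : ℕ} (hi : i ≤ q) (hq : q < scanUp A n x i) :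
    A q < x := by
  fun_induction scanUp A n x i with
  | case1 i h ih =>
    rcases Nat.eq_or_lt_of_le hi with rfl | h2
    · exact h.2
    · exact ih h2 hq
  | case2 => omega

theorem le_apply_scanUp (A : ℕ → ℕ) (n x i : ℕ) (h : scanUp A n x i < n) :
    x ≤ A (scanUp A n x i) := by
  fun_induction scanUp A n x i with
  | case1 i h' ih => exact ih h
  | case2 i h' => exact not_lt.1 fun h2 => h' ⟨h, h2⟩

/-- What the main loop achieves once the pivot `x` has been moved behind the right pointer:
the result is a rearrangement split at `leftSize`, and every exchange brings exactly one of the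
small entries beyond that border to its left. -/
theorem hoareLoop_spec (n x : ℕ) (A : ℕ → ℕ) (i j t : ℕ) (hi : 1 ≤ i) (hij : i ≤ j + 1)
    (hjn : j + 1 < n) (hlow : ∀ q < i, A q < x) (hmid : ∀ q, i ≤ q → q ≤ j → A q ≠ x)
    (hhigh : ∀ q, j < q → q < n → x ≤ A q) :
    i ≤ (hoareLoop n x A i j t).leftSize ∧
    (∀ q < (hoareLoop n x A i j t).leftSize, (hoareLoop n x A i j t).array q < x) ∧
    (∀ q, (hoareLoop n x A i j t).leftSize ≤ q → q < n → x ≤ (hoareLoop n x A i j t).array q) ∧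
    (∃ π : Equiv.Perm ℕ, (hoareLoop n x A i j t).array = A ∘ π ∧ ∀ q, n ≤ q → π q = q) ∧
    (hoareLoop n x A i j t).exchanges =
      t + ((Finset.range n).filter
        fun q => (hoareLoop n x A i j t).leftSize ≤ q ∧ A q < x).card := by
  fun_induction hoareLoop n x A i j t with
  | case1 A i j t j' i' h ih =>
    have hj' : j' ≤ j := scanDown_le A x j
    have hi' : i ≤ i' := le_scanUp A n x i
    have hdn : ∀ q, j' < q → q ≤ j → x < A q := fun q => lt_of_scanDown_lt A x
    have hup : ∀ q, i ≤ q → q < i' → A q < x := fun q => lt_of_lt_scanUp A n x i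
    have hAj : A j' < x := by
      refine lt_of_le_of_ne ?_ (hmid j' (by omega) hj')
      exact apply_scanDown_le A x (q := i - 1) (by omega) (hlow _ (by omega)).le
    have hAi : x ≤ A i' := le_apply_scanUp A n x i (show i' < n by omega)
    have hle := hoareLoop_leftSize_le n x (A ∘ Equiv.swap i' j') (i' + 1) (j' - 1) (t + 1)
    have hsw : ∀ q, q ≠ i' → q ≠ j' → (A ∘ Equiv.swap i' j') q = A q := fun q h1 h2 => by
      simp [Equiv.swap_apply_of_ne_of_ne h1 h2]
    have hswi : (A ∘ Equiv.swap i' j') i' = A j' := by simp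
    have hswj : (A ∘ Equiv.swap i' j') j' = A i' := by simp
    obtain ⟨h1, h2, h3, ⟨π, h4, h4'⟩, h5⟩ := ih (by omega) (by omega) (by omega)
      (by
        intro q hq
        rcases eq_or_ne q i' with rfl | hne
        · rwa [hswi]
        · rw [hsw q hne (by omega)]
          rcases Nat.lt_or_ge q i with h6 | h6
          · exact hlow q h6
          · exact hup q h6 (by omega))
      (by
        intro q hq hq'
        rw [hsw q (by omega) (by omega)]
        exact hmid q (by omega) (by omega))
      (by
        intro q hq hq'
        rcases eq_or_ne q j' with rfl | hne
        · rwa [hswj]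
        · rw [hsw q (by omega) hne]
          rcases Nat.lt_or_ge j q with h6 | h6
          · exact hhigh q h6 hq'
          · exact (hdn q (by omega) h6).le)
    refine ⟨by omega, h2, h3, ⟨Equiv.swap i' j' * π, ?_, ?_⟩, ?_⟩
    · rw [h4]; rfl
    · intro q hq
      rw [Equiv.Perm.mul_apply, h4' q hq, Equiv.swap_apply_of_ne_of_ne] <;> omega
    · rw [h5]
      have : ((Finset.range n).filter fun q =>
          (hoareLoop n x (A ∘ Equiv.swap i' j') (i' + 1) (j' - 1) (t + 1)).leftSize ≤ q ∧ A q < x) =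
          insert j' ((Finset.range n).filter fun q =>
          (hoareLoop n x (A ∘ Equiv.swap i' j') (i' + 1) (j' - 1) (t + 1)).leftSize ≤ q ∧
            (A ∘ Equiv.swap i' j') q < x) := by
        ext q
        simp only [Finset.mem_filter, Finset.mem_range, Finset.mem_insert]
        rcases eq_or_ne q j' with rfl | hne
        · simp only [true_or, iff_true]
          exact ⟨by omega, by omega, hAj⟩
        · rcases eq_or_ne q i' with rfl | hne'
          · omega
          · rw [hsw q hne' hne]; simp [hne]
      rw [this, Finset.card_insert_of_notMem]
      · omega
      · simp only [Finset.mem_filter, hswj]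
        omega
  | case2 A i j t j' i' h =>
    have hj' : j' ≤ j := scanDown_le A x j
    have hi' : i ≤ i' := le_scanUp A n x i
    have hdn : ∀ q, j' < q → q ≤ j → x < A q := fun q => lt_of_scanDown_lt A x
    have hup : ∀ q, i ≤ q → q < i' → A q < x := fun q => lt_of_lt_scanUp A n x i
    have hAj : A j' ≤ x :=
      apply_scanDown_le A x (q := i - 1) (by omega) (hlow _ (by omega)).le
    have hhi : ∀ q, j' < q → q < n → x ≤ A q := fun q h1 h2 => by
      rcases Nat.lt_or_ge j q with h6 | h6
      · exact hhigh q h6 h2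
      · exact (hdn q h1 h6).le
    have hge : i ≤ j' + 1 := by
      by_contra hc
      have := hdn (i - 1) (by omega) (by omega)
      have := hlow (i - 1) (by omega)
      omega
    refine ⟨hge, ?_, fun q h1 h2 => hhi q h1 h2, ⟨1, rfl, fun _ _ => rfl⟩, ?_⟩
    · intro q hq
      change q < j' + 1 at hq
      change A q < x
      rcases Nat.lt_or_ge q i with h6 | h6
      · exact hlow q h6
      · rcases eq_or_ne q j' with rfl | hne
        · exact lt_of_le_of_ne hAj (hmid _ h6 hj')
        · exact hup q h6 (by omega)
    · change t = t + _
      rw [left_eq_add, Finset.card_eq_zero, Finset.filter_eq_empty_iff]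
      intro q hq hq'
      have := hhi q (by have := hq'.1; change j' + 1 ≤ q at this; omega) (by simpa using hq)
      omega

theorem scanUp_zero_apply (A : ℕ → ℕ) (n : ℕ) : scanUp A n (A 0) 0 = 0 := by
  unfold scanUp
  simp

/-- If the pivot is the smallest entry then it is split off without any exchange. -/
theorem hoarePartition_of_min (A : ℕ → ℕ) {n : ℕ} (h : ∀ q, 1 ≤ q → q < n → A 0 < A q) :
    hoarePartition A n = ⟨A, 1, 0⟩ := by
  have h0 : scanDown A (A 0) (n - 1) = 0 := by
    by_contra hc
    have h1 := apply_scanDown_le A (A 0) (j := n - 1) (q := 0) (by omega) le_rfl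
    have h2 := scanDown_le A (A 0) (n - 1)
    have := h _ (Nat.pos_of_ne_zero hc) (by omega)
    omega
  unfold hoarePartition hoareLoop
  simp [h0]

/-- The partition of an arrangement of `c, …, c + n - 1` whose first entry is `c + k` with `k ≥ 1`:
the left sub-list has size `k`, and the number of exchanges is the number of small entries which
are initially outside the first `k` positions. -/
theorem hoarePartition_spec (A : ℕ → ℕ) {n c k : ℕ}
    (hA : Set.BijOn A (Set.Iio n) (Set.Ico c (c + n))) (h0 : A 0 = c + k) (hk : 1 ≤ k)
    (hkn : k < n) :
    (hoarePartition A n).leftSize = k ∧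
    Set.BijOn (hoarePartition A n).array (Set.Iio k) (Set.Ico c (c + k)) ∧
    Set.BijOn (fun q => (hoarePartition A n).array (k + q)) (Set.Iio (n - k))
      (Set.Ico (c + k) (c + n)) ∧
    (hoarePartition A n).exchanges =
      ((Finset.range n).filter fun q => k ≤ q ∧ A q < c + k).card := by
  obtain ⟨q0, hq0, hAq0⟩ : ∃ q < n, A q = c :=
    hA.surjOn (show c ∈ Set.Ico c (c + n) from ⟨le_rfl, by omega⟩)
  have hinj : ∀ p q, p < n → q < n → A p = A q → p = q := fun p q hp hq h => hA.injOn hp hq h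
  set d := scanDown A (A 0) (n - 1) with hd
  have hdl : d ≤ n - 1 := scanDown_le _ _ _
  have hdn : ∀ q, d < q → q < n → A 0 < A q := fun q h1 h2 =>
    lt_of_scanDown_lt A (A 0) (j := n - 1) h1 (by omega)
  have hAd : A d ≤ A 0 := apply_scanDown_le A (A 0) (q := 0) (by omega) le_rfl
  have hd1 : 1 ≤ d := by
    by_contra hc
    have := hdn q0 (by
      rcases Nat.eq_zero_or_pos q0 with rfl | h <;> omega) hq0
    omega
  have hAd' : A d < A 0 := lt_of_le_of_ne hAd fun h => by
    have := hinj _ _ (by omega) (by omega) h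
    omega
  have heq : hoarePartition A n = hoareLoop n (A 0) (A ∘ Equiv.swap 0 d) 1 (d - 1) 1 := by
    unfold hoarePartition
    rw [hoareLoop]
    simp only [scanUp_zero_apply, ← hd]
    rw [if_pos (by omega)]
  have hsw : ∀ q, q ≠ 0 → q ≠ d → (A ∘ Equiv.swap 0 d) q = A q := fun q h1 h2 => by
    simp [Equiv.swap_apply_of_ne_of_ne h1 h2]
  have hsw0 : (A ∘ Equiv.swap 0 d) 0 = A d := by simp
  have hswd : (A ∘ Equiv.swap 0 d) d = A 0 := by simp
  obtain ⟨h1, h2, h3, ⟨π, h4, h4'⟩, h5⟩ :=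
    hoareLoop_spec n (A 0) (A ∘ Equiv.swap 0 d) 1 (d - 1) 1 le_rfl (by omega) (by omega)
      (by
        intro q hq
        obtain rfl : q = 0 := by omega
        rwa [hsw0])
      (by
        intro q hq hq'
        rw [hsw q (by omega) (by omega)]
        intro h
        have := hinj _ _ (by omega) (by omega) h
        omega)
      (by
        intro q hq hq'
        rcases eq_or_ne q d with rfl | hne
        · rw [hswd]
        · rw [hsw q (by omega) hne]
          exact (hdn q (by omega) hq').le)
  have hle := hoareLoop_leftSize_le n (A 0) (A ∘ Equiv.swap 0 d) 1 (d - 1) 1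
  rw [← heq] at h1 h2 h3 h4 h5 hle
  set P := hoarePartition A n with hP
  -- the rearranged array is again an arrangement of the same keys
  have hbij : Set.BijOn P.array (Set.Iio n) (Set.Ico c (c + n)) := by
    have e : P.array = A ∘ (Equiv.swap 0 d * π) := by rw [h4]; rfl
    rw [e]
    refine hA.comp ?_
    have hfix : ∀ q, n ≤ q → (Equiv.swap 0 d * π) q = q := fun q hq => by
      rw [Equiv.Perm.mul_apply, h4' q hq, Equiv.swap_apply_of_ne_of_ne] <;> omega
    generalize Equiv.swap 0 d * π = ρ at hfix
    have hmaps : Set.MapsTo ρ (Set.Iio n) (Set.Iio n) := by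
      intro q hq
      by_contra hc
      have := ρ.injective (hfix (ρ q) (by simpa using hc))
      simp only [Set.mem_Iio] at hq hc
      omega
    refine ⟨hmaps, ρ.injective.injOn, fun q hq => ⟨ρ.symm q, ?_, by simp⟩⟩
    by_contra hc
    have := hfix (ρ.symm q) (by simpa using hc)
    rw [Equiv.apply_symm_apply] at this
    rw [← this] at hc
    exact hc hq
  have hsize : P.leftSize = k := by
    have e1 : (Finset.range P.leftSize).image P.array = Finset.Ico c (c + k) := by
      ext v
      simp only [Finset.mem_image, Finset.mem_range, Finset.mem_Ico]
      constructor
      · rintro ⟨q, hq, rfl⟩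
        have := hbij.mapsTo (show q ∈ Set.Iio n from by simp only [Set.mem_Iio]; omega)
        exact ⟨this.1, h0 ▸ h2 q hq⟩
      · rintro ⟨hv1, hv2⟩
        obtain ⟨q, hq, rfl⟩ := hbij.surjOn (show v ∈ Set.Ico c (c + n) from ⟨hv1, by omega⟩)
        refine ⟨q, ?_, rfl⟩
        by_contra hc
        have := h3 q (by omega) hq
        omega
    have e2 := congrArg Finset.card e1
    rw [Finset.card_image_of_injOn, Finset.card_range, Nat.card_Ico] at e2
    · omega
    · intro p hp q hq h
      simp only [Finset.coe_range, Set.mem_Iio] at hp hq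
      exact hbij.injOn (show p < n by omega) (show q < n by omega) h
  rw [hsize] at h2 h3 h5
  refine ⟨hsize, ⟨?_, ?_, ?_⟩, ⟨?_, ?_, ?_⟩, ?_⟩
  · intro q hq
    exact ⟨(hbij.mapsTo (show q < n from lt_trans hq hkn)).1, h0 ▸ h2 q hq⟩
  · exact hbij.injOn.mono fun q hq => lt_trans hq hkn
  · rintro v ⟨hv1, hv2⟩
    obtain ⟨q, hq, rfl⟩ := hbij.surjOn (show v ∈ Set.Ico c (c + n) from ⟨hv1, by omega⟩)
    refine ⟨q, ?_, rfl⟩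
    by_contra hc
    have := h3 q (by simpa using hc) hq
    omega
  · intro q hq
    simp only [Set.mem_Iio] at hq
    exact ⟨h0 ▸ h3 (k + q) (by omega) (by omega),
      (hbij.mapsTo (show k + q < n by omega)).2⟩
  · intro p hp q hq h
    simp only [Set.mem_Iio] at hp hq
    have := hbij.injOn (show k + p < n by omega) (show k + q < n by omega) h
    omega
  · rintro v ⟨hv1, hv2⟩
    obtain ⟨q, hq, rfl⟩ := hbij.surjOn (show v ∈ Set.Ico c (c + n) from ⟨by omega, hv2⟩)
    have hkq : k ≤ q := by
      by_contra hc
      have := h2 q (by omega)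
      omega
    refine ⟨q - k, ?_, by simp [Nat.add_sub_cancel' hkq]⟩
    simp only [Set.mem_Iio] at hq ⊢
    omega
  · rw [h5]
    have : ((Finset.range n).filter fun q => k ≤ q ∧ A q < c + k) =
        insert d ((Finset.range n).filter fun q => k ≤ q ∧ (A ∘ Equiv.swap 0 d) q < A 0) := by
      ext q
      simp only [Finset.mem_filter, Finset.mem_range, Finset.mem_insert]
      rcases eq_or_ne q d with rfl | hne
      · simp only [true_or, iff_true]
        omega
      · rcases eq_or_ne q 0 with rfl | hne'
        · omega
        · rw [hsw q hne' hne, h0]; simp [hne]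
    rw [this, Finset.card_insert_of_notMem]
    · omega
    · simp only [Finset.mem_filter, hswd]
      omega

/-- The partitioning procedure only looks at the order of the keys relative to the pivot, so it
commutes with every relabelling of the keys that respects this order. -/
theorem hoareLoop_comp (n x : ℕ) (A : ℕ → ℕ) (i j t : ℕ) {f : ℕ → ℕ}
    (h1 : ∀ v, f v ≤ x ↔ v ≤ x) (h2 : ∀ v, f v < x ↔ v < x) :
    hoareLoop n x (f ∘ A) i j t =
      ⟨f ∘ (hoareLoop n x A i j t).array, (hoareLoop n x A i j t).leftSize,
        (hoareLoop n x A i j t).exchanges⟩ := by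
  have e1 : ∀ (A : ℕ → ℕ) j, scanDown (f ∘ A) x j = scanDown A x j := fun A j => by
    induction j with
    | zero => rfl
    | succ j ih => simp [scanDown, h1, ih]
  have e2 : ∀ (A : ℕ → ℕ) i, scanUp (f ∘ A) n x i = scanUp A n x i := fun A i => by
    fun_induction scanUp A n x i with
    | case1 i h ih => rw [scanUp, if_pos ⟨h.1, (h2 _).2 h.2⟩, ih]
    | case2 i h => rw [scanUp, if_neg fun h' => h ⟨h'.1, (h2 _).1 h'.2⟩]
  fun_induction hoareLoop n x A i j t with
  | case1 A i j t j' i' h ih =>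
    rw [hoareLoop]
    simp only [e1, e2]
    rw [if_pos h, Function.comp_assoc, ih]
  | case2 A i j t j' i' h =>
    rw [hoareLoop]
    simp only [e1, e2]
    rw [if_neg h]

theorem hoarePartition_comp (A : ℕ → ℕ) (n : ℕ) {f : ℕ → ℕ}
    (h1 : ∀ v, f v ≤ A 0 ↔ v ≤ A 0) (h2 : ∀ v, f v < A 0 ↔ v < A 0) :
    hoarePartition (f ∘ A) n =
      ⟨f ∘ (hoarePartition A n).array, (hoarePartition A n).leftSize,
        (hoarePartition A n).exchanges⟩ := by
  have h0 : f (A 0) = A 0 :=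
    le_antisymm ((h1 _).2 le_rfl) (not_lt.1 fun h => lt_irrefl _ ((h2 _).1 h))
  unfold hoarePartition
  rw [Function.comp_apply, h0]
  exact hoareLoop_comp n (A 0) A 0 (n - 1) 0 h1 h2

/-! ### One step of Quickselect -/

theorem quickselectExchanges_of_le_one (A : ℕ → ℕ) {n : ℕ} (hn : n ≤ 1) (r : ℕ) :
    quickselectExchanges A n r = 0 := by
  rw [quickselectExchanges, if_pos hn]

theorem hoarePartition_of_apply_zero_eq {A : ℕ → ℕ} {n c : ℕ}
    (hA : Set.BijOn A (Set.Iio n) (Set.Ico c (c + n))) (h0 : A 0 = c) :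
    hoarePartition A n = ⟨A, 1, 0⟩ := by
  refine hoarePartition_of_min A fun q hq hqn => ?_
  have h1 := hA.mapsTo (show q ∈ Set.Iio n from hqn)
  refine lt_of_le_of_ne (h0 ▸ h1.1) fun h => ?_
  have := hA.injOn (show 0 < n by omega) hqn h
  omega

theorem bijOn_tail {A : ℕ → ℕ} {n c : ℕ} (hA : Set.BijOn A (Set.Iio n) (Set.Ico c (c + n)))
    (hn : 2 ≤ n) (h0 : A 0 = c) :
    Set.BijOn (fun q => A (1 + q)) (Set.Iio (n - 1)) (Set.Ico (c + 1) (c + 1 + (n - 1))) := by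
  refine ⟨fun q hq => ?_, fun p hp q hq h => ?_, fun v hv => ?_⟩
  · simp only [Set.mem_Iio] at hq
    have h3 := hA.mapsTo (show 1 + q < n by omega)
    have h4 : A (1 + q) ≠ A 0 := fun h => by
      have := hA.injOn (show 1 + q < n by omega) (show 0 < n by omega) h
      omega
    simp only [Set.mem_Ico] at h3 ⊢
    omega
  · simp only [Set.mem_Iio] at hp hq
    have := hA.injOn (show 1 + p < n by omega) (show 1 + q < n by omega) h
    omega
  · simp only [Set.mem_Ico] at hv
    obtain ⟨q, hq, rfl⟩ := hA.surjOn (show v ∈ Set.Ico c (c + n) by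
      simp only [Set.mem_Ico]; omega)
    have : q ≠ 0 := by rintro rfl; omega
    simp only [Set.mem_Iio] at hq
    exact ⟨q - 1, by simp only [Set.mem_Iio]; omega, by simp only; congr 1; omega⟩

/-- Summation over all ranks, when the pivot is the smallest key. -/
theorem sum_quickselectExchanges_of_min {A : ℕ → ℕ} {n c : ℕ} (hn : 2 ≤ n)
    (hA : Set.BijOn A (Set.Iio n) (Set.Ico c (c + n))) (h0 : A 0 = c) (g : ℕ → ℝ) :
    ∑ r ∈ Finset.range n, g (quickselectExchanges A n (r + 1)) =
      g 0 + ∑ r ∈ Finset.range (n - 1),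
        g (quickselectExchanges (fun q => A (1 + q)) (n - 1) (r + 1)) := by
  have hP := hoarePartition_of_apply_zero_eq hA h0
  obtain ⟨m, rfl⟩ : ∃ m, n = m + 1 := ⟨n - 1, by omega⟩
  rw [Finset.sum_range_succ', add_comm]
  congr 1
  · rw [quickselectExchanges, if_neg (by omega), hP]
    simp [quickselectExchanges_of_le_one]
  · refine Finset.sum_congr rfl fun r _ => ?_
    rw [quickselectExchanges, if_neg (by omega), hP]
    simp

/-- Summation over all ranks, when the pivot is not the smallest key. -/
theorem sum_quickselectExchanges {A : ℕ → ℕ} {n c k : ℕ}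
    (hA : Set.BijOn A (Set.Iio n) (Set.Ico c (c + n))) (h0 : A 0 = c + k) (hk : 1 ≤ k)
    (hkn : k < n) (g : ℕ → ℝ) :
    ∑ r ∈ Finset.range n, g (quickselectExchanges A n (r + 1)) =
      ∑ r ∈ Finset.range k, g ((hoarePartition A n).exchanges +
        quickselectExchanges (hoarePartition A n).array k (r + 1)) +
      ∑ r ∈ Finset.range (n - k), g ((hoarePartition A n).exchanges +
        quickselectExchanges (fun q => (hoarePartition A n).array (k + q)) (n - k) (r + 1)) := by
  obtain ⟨h1, -⟩ := hoarePartition_spec A hA h0 hk hkn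
  obtain ⟨d, rfl⟩ := Nat.exists_eq_add_of_le hkn.le
  rw [Finset.sum_range_add, Nat.add_sub_cancel_left]
  congr 1
  · refine Finset.sum_congr rfl fun r hr => ?_
    rw [Finset.mem_range] at hr
    rw [quickselectExchanges, if_neg (by omega)]
    simp only [h1]
    rw [if_pos (by omega)]
  · refine Finset.sum_congr rfl fun r hr => ?_
    rw [quickselectExchanges, if_neg (by omega)]
    simp only [h1]
    rw [if_neg (by omega), Nat.add_sub_cancel_left, show k + r + 1 - k = r + 1 by omega]

theorem hoarePartition_exchanges_le {A : ℕ → ℕ} {n c k : ℕ}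
    (hA : Set.BijOn A (Set.Iio n) (Set.Ico c (c + n))) (h0 : A 0 = c + k) (hk : 1 ≤ k)
    (hkn : k < n) :
    (hoarePartition A n).exchanges ≤ k ∧ (hoarePartition A n).exchanges ≤ n - k := by
  obtain ⟨-, -, -, h⟩ := hoarePartition_spec A hA h0 hk hkn
  rw [h]
  constructor
  · rw [← Finset.card_image_of_injOn (f := A)]
    · refine (Finset.card_le_card (t := Finset.Ico c (c + k)) fun v hv => ?_).trans (by simp)
      simp only [Finset.mem_image, Finset.mem_filter, Finset.mem_range] at hv
      obtain ⟨q, ⟨hq, -, hq'⟩, rfl⟩ := hv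
      exact Finset.mem_Ico.2 ⟨(hA.mapsTo (show q ∈ Set.Iio n from hq)).1, hq'⟩
    · intro p hp q hq hpq
      simp only [Finset.coe_filter, Finset.mem_range, Set.mem_ofPred_eq] at hp hq
      exact hA.injOn hp.1 hq.1 hpq
  · refine (Finset.card_le_card (t := Finset.Ico k n) fun q hq => ?_).trans (by simp)
    simp only [Finset.mem_filter, Finset.mem_range] at hq
    exact Finset.mem_Ico.2 ⟨hq.2.1, hq.1⟩

/-- Going on with a list of size `k` or `n - k` after at most `min k (n - k)` exchanges never
leads to more than `n` exchanges. -/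
theorem quickselectExchanges_le {A : ℕ → ℕ} {n c : ℕ}
    (hA : Set.BijOn A (Set.Iio n) (Set.Ico c (c + n))) (r : ℕ) :
    quickselectExchanges A n r ≤ n := by
  induction n using Nat.strong_induction_on generalizing A c r with
  | _ n ih =>
    rcases Nat.lt_or_ge n 2 with hn | hn
    · rw [quickselectExchanges_of_le_one A (by omega)]; omega
    obtain ⟨h1, h2⟩ := hA.mapsTo (show 0 ∈ Set.Iio n from by simp only [Set.mem_Iio]; omega)
    obtain ⟨k, hk⟩ := Nat.exists_eq_add_of_le h1
    rcases Nat.eq_zero_or_pos k with rfl | hk1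
    · have hP := hoarePartition_of_apply_zero_eq hA hk
      rw [quickselectExchanges, if_neg (by omega), hP]
      simp only
      split_ifs
      · rw [quickselectExchanges_of_le_one A le_rfl]; omega
      · have := ih (n - 1) (by omega) (bijOn_tail hA hn hk) (r - 1)
        omega
    · have hkn : k < n := by omega
      obtain ⟨h3, h4, h5, -⟩ := hoarePartition_spec A hA hk hk1 hkn
      obtain ⟨h6, h7⟩ := hoarePartition_exchanges_le hA hk hk1 hkn
      rw [quickselectExchanges, if_neg (by omega)]
      simp only [h3]
      split_ifs
      · have := ih k hkn h4 r
        omega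
      · have := ih (n - k) (by omega) (c := c + k)
          (by rwa [show c + k + (n - k) = c + n by omega]) (r - k)
        omega

/-! ### Random arrays with exchangeable keys above the minimum -/

/-- A random array, given by the arrays `A ω` with weights `w ω`, is *exchangeable above the
minimum* if it is an arrangement of `c, …, c + m - 1` and its law is invariant under all
permutations of these keys that fix the smallest key `c`. The total weight need not be one.
Only the first `m` entries matter, but the law of the whole sequence is required to be
invariant. -/
structure IsMinExchangeable {Ω : Type} [Fintype Ω] (w : Ω → ℝ) (A : Ω → ℕ → ℕ) (m c : ℕ) :
    Prop where
  nonneg : ∀ ω, 0 ≤ w ω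
  bijOn : ∀ ω, w ω ≠ 0 → Set.BijOn (A ω) (Set.Iio m) (Set.Ico c (c + m))
  invariant : ∀ π : Equiv.Perm ℕ, (∀ v, v ∉ Set.Ioo c (c + m) → π v = v) →
    ∀ F : (ℕ → ℕ) → ℝ, ∑ ω, w ω * F (π ∘ A ω) = ∑ ω, w ω * F (A ω)

namespace IsMinExchangeable

variable {Ω : Type} [Fintype Ω] {w : Ω → ℝ} {A : Ω → ℕ → ℕ} {m c : ℕ}

/-- Conditioning on an event `p` and passing to another array `Φ B` preserves exchangeability
if both are compatible with the permutations of the keys of the new array. -/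
theorem map (h : IsMinExchangeable w A m c) {m' c' : ℕ} (p : (ℕ → ℕ) → Prop) [DecidablePred p]
    (Φ : (ℕ → ℕ) → ℕ → ℕ) (hsub : Set.Ioo c' (c' + m') ⊆ Set.Ioo c (c + m))
    (hbij : ∀ B, Set.BijOn B (Set.Iio m) (Set.Ico c (c + m)) → p B →
      Set.BijOn (Φ B) (Set.Iio m') (Set.Ico c' (c' + m')))
    (hp : ∀ π : Equiv.Perm ℕ, (∀ v, v ∉ Set.Ioo c' (c' + m') → π v = v) →
      ∀ B, p (π ∘ B) ↔ p B)
    (hΦ : ∀ π : Equiv.Perm ℕ, (∀ v, v ∉ Set.Ioo c' (c' + m') → π v = v) →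
      ∀ B, p B → Φ (π ∘ B) = π ∘ Φ B) :
    IsMinExchangeable (fun ω => if p (A ω) then w ω else 0) (fun ω => Φ (A ω)) m' c' where
  nonneg ω := by
    split_ifs
    · exact h.nonneg ω
    · exact le_rfl
  bijOn ω hω := by
    have h1 : p (A ω) := by by_contra hc; simp [hc] at hω
    exact hbij _ (h.bijOn ω (by simpa [h1] using hω)) h1
  invariant π hπ F := by
    have := h.invariant π (fun v hv => hπ v fun hv' => hv (hsub hv'))
      fun B => if p B then F (Φ B) else 0
    simp only [hp π hπ] at this
    convert this using 2 with ω _ ω _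
    · by_cases h1 : p (A ω)
      · simp [h1, hΦ π hπ _ h1]
      · simp [h1]
    · simp

/-- A permutation that only moves keys strictly between two bounds which both lie on the same
side of `x`, or at `x`, respects the order relative to `x`. -/
theorem perm_order {π : Equiv.Perm ℕ} {a b x : ℕ} (hπ : ∀ v, v ∉ Set.Ioo a b → π v = v)
    (hx : b ≤ x ∨ x ≤ a) : (∀ v, π v ≤ x ↔ v ≤ x) ∧ ∀ v, π v < x ↔ v < x := by
  have hmaps : ∀ v, v ∈ Set.Ioo a b → π v ∈ Set.Ioo a b := fun v hv => by
    by_contra hc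
    rw [π.injective (hπ _ hc)] at hc
    exact hc hv
  constructor <;>
  · intro v
    by_cases hv : v ∈ Set.Ioo a b
    · have := hmaps v hv
      simp only [Set.mem_Ioo] at hv this
      omega
    · rw [hπ v hv]

theorem pivot_pred {π : Equiv.Perm ℕ} {a b x m t : ℕ} (hπ : ∀ v, v ∉ Set.Ioo a b → π v = v)
    (hx : b ≤ x ∨ x ≤ a) (B : ℕ → ℕ) :
    ((π ∘ B) 0 = x ∧ (hoarePartition (π ∘ B) m).exchanges = t) ↔
      (B 0 = x ∧ (hoarePartition B m).exchanges = t) := by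
  obtain ⟨h1, h2⟩ := perm_order hπ hx
  have h3 : π x = x := le_antisymm ((h1 x).2 le_rfl) (not_lt.1 fun h => lt_irrefl _ ((h2 x).1 h))
  have h4 : (π ∘ B) 0 = x ↔ B 0 = x := by
    rw [Function.comp_apply]
    exact ⟨fun h => π.injective (h.trans h3.symm), fun h => by rw [h, h3]⟩
  rw [h4]
  refine and_congr_right fun h => ?_
  subst h
  rw [hoarePartition_comp B m h1 h2]

/-- The left sub-list, given the rank of the pivot and the number of exchanges. -/
theorem left (h : IsMinExchangeable w A m c) {k : ℕ} (hk : 1 ≤ k) (hkm : k < m) (t : ℕ) :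
    IsMinExchangeable
      (fun ω => if A ω 0 = c + k ∧ (hoarePartition (A ω) m).exchanges = t then w ω else 0)
      (fun ω => (hoarePartition (A ω) m).array) k c := by
  refine h.map (fun B => B 0 = c + k ∧ (hoarePartition B m).exchanges = t)
    (fun B => (hoarePartition B m).array) (Set.Ioo_subset_Ioo_right (by omega)) ?_ ?_ ?_
  · intro B hB hp
    exact (hoarePartition_spec B hB hp.1 hk hkm).2.1
  · intro π hπ B
    exact pivot_pred hπ (Or.inl le_rfl) B
  · rintro π hπ B ⟨hp, -⟩
    obtain ⟨h1, h2⟩ := perm_order hπ (Or.inl le_rfl)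
    rw [hoarePartition_comp B m (hp ▸ h1) (hp ▸ h2)]

/-- The right sub-list, given the rank of the pivot and the number of exchanges. Its smallest
key is the pivot, whose position need not be uniform. -/
theorem right (h : IsMinExchangeable w A m c) {k : ℕ} (hk : 1 ≤ k) (hkm : k < m) (t : ℕ) :
    IsMinExchangeable
      (fun ω => if A ω 0 = c + k ∧ (hoarePartition (A ω) m).exchanges = t then w ω else 0)
      (fun ω q => (hoarePartition (A ω) m).array (k + q)) (m - k) (c + k) := by
  have e : c + k + (m - k) = c + m := by omega
  refine h.map (fun B => B 0 = c + k ∧ (hoarePartition B m).exchanges = t)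
    (fun B q => (hoarePartition B m).array (k + q)) ?_ ?_ ?_ ?_
  · rw [e]
    exact Set.Ioo_subset_Ioo_left (by omega)
  · intro B hB hp
    rw [e]
    exact (hoarePartition_spec B hB hp.1 hk hkm).2.2.1
  · intro π hπ B
    exact pivot_pred hπ (Or.inr le_rfl) B
  · rintro π hπ B ⟨hp, -⟩
    obtain ⟨h1, h2⟩ := perm_order hπ (Or.inr le_rfl)
    rw [hoarePartition_comp B m (hp ▸ h1) (hp ▸ h2)]
    rfl

/-- If the pivot is the smallest key, the algorithm goes on with the remaining entries. -/
theorem tail (h : IsMinExchangeable w A m c) (hm : 2 ≤ m) :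
    IsMinExchangeable (fun ω => if A ω 0 = c then w ω else 0)
      (fun ω q => A ω (1 + q)) (m - 1) (c + 1) := by
  refine h.map (fun B => B 0 = c) (fun B q => B (1 + q)) ?_ ?_ ?_ ?_
  · exact Set.Ioo_subset_Ioo (by omega) (by omega)
  · intro B hB h0
    exact bijOn_tail hB hm h0
  · intro π hπ B
    have h1 : π c = c := hπ c (by simp)
    exact ⟨fun h => π.injective (h.trans h1.symm), fun h => by
      rw [Function.comp_apply, h, h1]⟩
  · intro π _ B _
    rfl

theorem swap (h : IsMinExchangeable w A m c) {a b : ℕ} (ha : a ∈ Set.Ioo c (c + m))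
    (hb : b ∈ Set.Ioo c (c + m)) (F : (ℕ → ℕ) → ℝ) :
    ∑ ω, w ω * F (Equiv.swap a b ∘ A ω) = ∑ ω, w ω * F (A ω) := by
  refine h.invariant _ (fun v hv => Equiv.swap_apply_of_ne_of_ne ?_ ?_) F
  · rintro rfl; exact hv ha
  · rintro rfl; exact hv hb

/-- The decomposition according to the rank of the pivot. -/
theorem eq_sum_pivot (h : IsMinExchangeable w A m c) (hm : 1 ≤ m) (ω : Ω) :
    w ω = (if A ω 0 = c then w ω else 0) +
      ∑ j ∈ Finset.range (m - 1), if A ω 0 = c + (j + 1) then w ω else 0 := by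
  by_cases hw : w ω = 0
  · simp [hw]
  have h3 := (h.bijOn ω hw).mapsTo (show 0 ∈ Set.Iio m from by simp only [Set.mem_Iio]; omega)
  have h4 := Finset.sum_range_succ' (fun j => if A ω 0 = c + j then w ω else 0) (m - 1)
  simp only [add_zero] at h4
  rw [add_comm, ← h4, Nat.sub_add_cancel (by omega)]
  rw [Finset.sum_eq_single (A ω 0 - c)]
  · rw [if_pos]; have := h3.1; omega
  · intro b _ hb; rw [if_neg]; omega
  · intro hc
    simp only [Set.mem_Ico, Finset.mem_range] at h3 hc
    omega

/-- All keys but the smallest are equally likely to be the pivot. -/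
theorem pivot_weight (h : IsMinExchangeable w A m c) {k : ℕ} (hk : 1 ≤ k) (hkm : k < m) :
    (m - 1 : ℝ) * (∑ ω, if A ω 0 = c + k then w ω else 0) =
      (∑ ω, w ω) - ∑ ω, if A ω 0 = c then w ω else 0 := by
  have h1 : ∀ j ∈ Finset.range (m - 1), (∑ ω, if A ω 0 = c + (j + 1) then w ω else 0) =
      ∑ ω, if A ω 0 = c + k then w ω else 0 := by
    intro j hj
    rw [Finset.mem_range] at hj
    have := h.swap (a := c + (j + 1)) (b := c + k) ⟨by omega, by omega⟩ ⟨by omega, by omega⟩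
      fun B => if B 0 = c + k then 1 else 0
    simp only [mul_ite, mul_one, mul_zero, Function.comp_apply] at this
    rw [← this]
    refine Finset.sum_congr rfl fun ω _ => ?_
    congr 1
    rw [Equiv.swap_apply_eq_iff, Equiv.swap_apply_right]
  have h5 : (∑ ω, w ω) = (∑ ω, if A ω 0 = c then w ω else 0) +
      ∑ j ∈ Finset.range (m - 1), (∑ ω, if A ω 0 = c + (j + 1) then w ω else 0) := by
    rw [Finset.sum_comm, ← Finset.sum_add_distrib]
    exact Finset.sum_congr rfl fun ω _ => h.eq_sum_pivot (by omega) ω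
  rw [h5, Finset.sum_congr rfl h1, Finset.sum_const, Finset.card_range, nsmul_eq_mul,
    Nat.cast_sub (by omega)]
  simp

/-- If the smallest key comes first, then all keys but that one are equally likely to come
second. -/
theorem second_weight (h : IsMinExchangeable w A m c) (hm : 2 ≤ m) :
    (m - 1 : ℝ) * (∑ ω, if A ω 1 = c + 1 then if A ω 0 = c then w ω else 0 else 0) =
      ∑ ω, if A ω 0 = c then w ω else 0 := by
  have h1 : ∀ j ∈ Finset.range (m - 1),
      (∑ ω, if A ω 1 = c + (j + 1) then if A ω 0 = c then w ω else 0 else 0) =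
      ∑ ω, if A ω 1 = c + 1 then if A ω 0 = c then w ω else 0 else 0 := by
    intro j hj
    rw [Finset.mem_range] at hj
    have := h.swap (a := c + (j + 1)) (b := c + 1) ⟨by omega, by omega⟩ ⟨by omega, by omega⟩
      fun B => if B 1 = c + 1 then if B 0 = c then 1 else 0 else 0
    simp only [mul_ite, mul_one, mul_zero, Function.comp_apply] at this
    rw [← this]
    refine Finset.sum_congr rfl fun ω _ => ?_
    refine if_congr ?_ (if_congr ?_ rfl rfl) rfl
    · rw [Equiv.swap_apply_eq_iff, Equiv.swap_apply_right]
    · rw [Equiv.swap_apply_eq_iff, Equiv.swap_apply_of_ne_of_ne (by omega) (by omega)]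
  have h2 : ∀ ω, (if A ω 0 = c then w ω else 0) = ∑ j ∈ Finset.range (m - 1),
      if A ω 1 = c + (j + 1) then if A ω 0 = c then w ω else 0 else 0 := by
    intro ω
    by_cases h0 : A ω 0 = c
    swap
    · simp [h0]
    by_cases hw : w ω = 0
    · simp [hw]
    have hb := h.bijOn ω hw
    have h3 := hb.mapsTo (show 1 ∈ Set.Iio m from by simp only [Set.mem_Iio]; omega)
    have h4 : A ω 1 ≠ A ω 0 := fun h => by
      have := hb.injOn (show 1 < m by omega) (show 0 < m by omega) h
      omega
    simp only [Set.mem_Ico] at h3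
    rw [Finset.sum_eq_single (A ω 1 - c - 1)]
    · rw [if_pos (c := A ω 1 = _)]; omega
    · intro b _ hb; rw [if_neg]; omega
    · intro hc
      simp only [Finset.mem_range] at hc
      omega
  rw [Finset.sum_congr rfl fun ω _ => h2 ω, Finset.sum_comm, Finset.sum_congr rfl h1,
    Finset.sum_const, Finset.card_range, nsmul_eq_mul, Nat.cast_sub (by omega)]
  simp

end IsMinExchangeable

/-! ### The distributional equation for Lipschitz test functions -/

section RDE

variable {ν : Measure ℝ} [IsProbabilityMeasure ν]

theorem integrable_of_continuous_of_mem_Icc (h01 : ∀ᵐ x ∂ν, x ∈ Set.Icc (0 : ℝ) 1) {f : ℝ → ℝ}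
    (hf : Continuous f) : Integrable f ν := by
  have h : IntegrableOn f (Set.Icc (0 : ℝ) 1) ν :=
    hf.continuousOn.integrableOn_compact isCompact_Icc
  rwa [IntegrableOn, Measure.restrict_eq_self_of_ae_mem h01] at h

theorem IsRDESolution.integral_eq (h01 : ∀ᵐ x ∂ν, x ∈ Set.Icc (0 : ℝ) 1) (hR : IsRDESolution ν)
    {f : ℝ → ℝ} (hf : Continuous f) :
    ∫ x, f x ∂ν = ∫ u in (0 : ℝ)..1, ∫ x, f (√u * (1 - √u) + √u * x) ∂ν := by
  have hm : Measurable fun p : ℝ × ℝ => √p.2 * p.1 + √p.2 * (1 - √p.2) := by fun_prop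
  have hi : Integrable f ν := integrable_of_continuous_of_mem_Icc h01 hf
  have hR' := hR
  rw [IsRDESolution] at hR'
  have hi' : Integrable (fun p : ℝ × ℝ => f (√p.2 * p.1 + √p.2 * (1 - √p.2)))
      (ν.prod (volume.restrict (Set.Icc (0 : ℝ) 1))) := by
    rw [← hR'] at hi
    exact (integrable_map_measure hf.aestronglyMeasurable hm.aemeasurable).1 hi
  conv_lhs => rw [← hR']
  rw [integral_map hm.aemeasurable hf.aestronglyMeasurable, integral_prod_symm _ hi',
    intervalIntegral.integral_of_le zero_le_one, integral_Icc_eq_integral_Ioc]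
  simp only [add_comm]

theorem abs_integral_sub_le (h01 : ∀ᵐ x ∂ν, x ∈ Set.Icc (0 : ℝ) 1) {g : ℝ → ℝ}
    (hg : LipschitzWith 1 g) (a b s t : ℝ) :
    |∫ x, g (a + s * x) ∂ν - ∫ x, g (b + t * x) ∂ν| ≤ |a - b| + |s - t| := by
  have hc : ∀ a s : ℝ, Integrable (fun x => g (a + s * x)) ν := fun a s =>
    integrable_of_continuous_of_mem_Icc h01 (hg.continuous.comp (by fun_prop))
  rw [← integral_sub (hc a s) (hc b t), ← Real.norm_eq_abs]
  refine (norm_integral_le_of_norm_le_const (C := |a - b| + |s - t|) ?_).trans (by simp)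
  filter_upwards [h01] with x hx
  have := hg.dist_le_mul (a + s * x) (b + t * x)
  simp only [Real.dist_eq, NNReal.coe_one, one_mul] at this
  rw [Real.norm_eq_abs]
  refine this.trans ?_
  rw [show a + s * x - (b + t * x) = (a - b) + (s - t) * x by ring]
  refine (abs_add_le _ _).trans (add_le_add le_rfl ?_)
  rw [abs_mul, abs_of_nonneg hx.1]
  exact mul_le_of_le_one_right (abs_nonneg _) hx.2

/-- The law of the fraction of the keys that remain when the pivot has a uniform rank, which gives
the weight `2 k / (m (m - 1))` to `k / m`, is close to the law of `√U`. The two are coupled on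
intervals of exactly these lengths. -/
theorem abs_integral_sqrt_sub_sum_le {h : ℝ → ℝ} {K : ℝ} (hK : 0 ≤ K)
    (hh : ∀ v ∈ Set.Icc (0 : ℝ) 1, ∀ v' ∈ Set.Icc (0 : ℝ) 1, |h v - h v'| ≤ K * |v - v'|)
    {m : ℕ} (hm : 2 ≤ m) :
    |(∑ j ∈ Finset.range (m - 1), 2 * ((j : ℝ) + 1) / (m * (m - 1)) * h (((j : ℝ) + 1) / m)) -
      ∫ u in (0 : ℝ)..1, h (√u)| ≤ K / m := by
  have hm' : (2 : ℝ) ≤ m := by exact_mod_cast hm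
  have hcont : ContinuousOn (fun u => h (√u)) (Set.Icc 0 1) := by
    have : ContinuousOn h (Set.Icc 0 1) := by
      have : LipschitzOnWith ⟨K, hK⟩ h (Set.Icc 0 1) :=
        LipschitzOnWith.of_dist_le_mul fun v hv v' hv' => by
          rw [Real.dist_eq, Real.dist_eq]
          exact hh v hv v' hv'
      exact this.continuousOn
    refine this.comp Real.continuous_sqrt.continuousOn fun u hu => ?_
    exact ⟨Real.sqrt_nonneg _, Real.sqrt_le_one.2 hu.2⟩
  set a : ℕ → ℝ := fun j => (j : ℝ) * (j + 1) / (m * (m - 1)) with ha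
  have hD : (0 : ℝ) < m * (m - 1) := by nlinarith
  have ha_step : ∀ j, a (j + 1) - a j = 2 * ((j : ℝ) + 1) / (m * (m - 1)) := fun j => by
    simp only [ha]
    push_cast
    rw [← sub_div]
    congr 1
    ring
  have ha_le : ∀ j, a j ≤ a (j + 1) := fun j => by
    rw [← sub_nonneg, ha_step]
    positivity
  have ha0 : a 0 = 0 := by simp [ha]
  have ha1 : a (m - 1) = 1 := by
    simp only [ha]
    rw [Nat.cast_sub (by omega)]
    rw [div_eq_one_iff_eq hD.ne']
    push_cast
    ring
  have hmono : Monotone a := monotone_nat_of_le_succ ha_le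
  have hsub : ∀ j, j < m - 1 → Set.Icc (a j) (a (j + 1)) ⊆ Set.Icc 0 1 := fun j hj =>
    Set.Icc_subset_Icc (ha0 ▸ hmono (Nat.zero_le j)) (ha1 ▸ hmono (by omega))
  have hint : ∀ j < m - 1, IntervalIntegrable (fun u => h (√u)) volume (a j) (a (j + 1)) :=
    fun j hj => by
      refine ContinuousOn.intervalIntegrable ?_
      rw [Set.uIcc_of_le (ha_le j)]
      exact hcont.mono (hsub j hj)
  have hsum := intervalIntegral.sum_integral_adjacent_intervals hint
  rw [ha0, ha1] at hsum
  rw [← hsum, ← Finset.sum_sub_distrib]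
  have hterm : ∀ j ∈ Finset.range (m - 1),
      |2 * ((j : ℝ) + 1) / (m * (m - 1)) * h (((j : ℝ) + 1) / m) -
        ∫ u in a j..a (j + 1), h (√u)| ≤ K / m * (a (j + 1) - a j) := by
    intro j hj
    rw [Finset.mem_range] at hj
    have hjm : (j : ℝ) + 2 ≤ m := by
      have : j + 2 ≤ m := by omega
      exact_mod_cast this
    have e : 2 * ((j : ℝ) + 1) / (m * (m - 1)) * h (((j : ℝ) + 1) / m) =
        ∫ u in a j..a (j + 1), h (((j : ℝ) + 1) / m) := by
      rw [intervalIntegral.integral_const, ha_step, smul_eq_mul]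
    rw [e, ← intervalIntegral.integral_sub (by simp) (hint j hj), ← Real.norm_eq_abs,
      ← abs_of_nonneg (sub_nonneg.2 (ha_le j))]
    refine intervalIntegral.norm_integral_le_of_norm_le_const fun u hu => ?_
    rw [Set.uIoc_of_le (ha_le j)] at hu
    have hu01 := hsub j hj ⟨hu.1.le, hu.2⟩
    have hmpos : (0 : ℝ) < m := by linarith
    have hj0 : (0 : ℝ) ≤ j := Nat.cast_nonneg j
    have h1 : (j : ℝ) / m ≤ √u := by
      refine Real.le_sqrt_of_sq_le (le_trans ?_ hu.1.le)
      simp only [ha]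
      rw [div_pow, div_le_div_iff₀ (by positivity) hD]
      have : (j : ℝ) ^ 2 * (m * (m - 1)) = j * m * (j * (m - 1)) := by ring
      rw [this, show (j : ℝ) * (j + 1) * m ^ 2 = j * m * ((j + 1) * m) by ring]
      gcongr <;> linarith
    have h2 : √u ≤ ((j : ℝ) + 2) / m := by
      refine Real.sqrt_le_iff.2 ⟨by positivity, hu.2.trans ?_⟩
      simp only [ha]
      push_cast
      rw [div_pow, div_le_div_iff₀ hD (by positivity)]
      have : ((j : ℝ) + 2) ^ 2 * (m * (m - 1)) = (j + 2) * m * ((j + 2) * (m - 1)) := by ring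
      rw [this, show ((j : ℝ) + 1) * (j + 1 + 1) * m ^ 2 = (j + 2) * m * ((j + 1) * m) by ring]
      gcongr (j + 2) * m * ?_
      nlinarith
    rw [Real.norm_eq_abs]
    refine (hh _ ⟨by positivity, (div_le_one hmpos).2 (by linarith)⟩ _
      ⟨Real.sqrt_nonneg _, Real.sqrt_le_one.2 hu01.2⟩).trans ?_
    rw [div_eq_mul_inv K]
    refine mul_le_mul_of_nonneg_left ?_ hK
    rw [add_div] at h2
    rw [abs_le, add_div, ← one_div]
    have : (2 : ℝ) / m = 1 / m + 1 / m := by ring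
    constructor <;> linarith
  refine (Finset.abs_sum_le_sum_abs _ _).trans ((Finset.sum_le_sum hterm).trans ?_)
  rw [← Finset.mul_sum, Finset.sum_range_sub, ha0, ha1]
  simp

/-- The solution of the distributional equation almost satisfies the discrete recursion in which
the size of the sub-list is size-biased and the number of exchanges is replaced by its mean. -/
theorem IsRDESolution.abs_sum_sub_integral_le (h01 : ∀ᵐ x ∂ν, x ∈ Set.Icc (0 : ℝ) 1)
    (hR : IsRDESolution ν) {g : ℝ → ℝ} (hg : LipschitzWith 1 g) {m : ℕ} (hm : 2 ≤ m) :
    |(∑ j ∈ Finset.range (m - 1), 2 * ((j : ℝ) + 1) / (m * (m - 1)) *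
        ∫ x, g (((j : ℝ) + 1) * (m - (j + 1)) / m + (j + 1) * x) ∂ν) -
      ∫ x, g (m * x) ∂ν| ≤ 2 := by
  have hm' : (0 : ℝ) < m := by
    have : 0 < m := by omega
    exact_mod_cast this
  have hc : Continuous fun x : ℝ => g (m * x) := hg.continuous.comp (by fun_prop)
  have := abs_integral_sqrt_sub_sum_le
    (h := fun v => ∫ x, g (m * (v * (1 - v)) + m * v * x) ∂ν) (K := 2 * m) (by positivity) ?_ hm
  · rw [mul_div_assoc, div_self hm'.ne', mul_one] at this
    rw [hR.integral_eq h01 hc]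
    convert this using 3
    · refine Finset.sum_congr rfl fun j _ => ?_
      have e1 : (m : ℝ) * (((j : ℝ) + 1) / m * (1 - ((j : ℝ) + 1) / m)) =
          ((j : ℝ) + 1) * (m - (j + 1)) / m := by
        field_simp
      have e2 : (m : ℝ) * (((j : ℝ) + 1) / m) = j + 1 := by field_simp
      simp only [e1, e2]
    · simp only [mul_add, mul_assoc]
  · intro v hv v' hv'
    refine (abs_integral_sub_le h01 hg _ _ _ _).trans ?_
    have e1 : (m : ℝ) * (v * (1 - v)) - m * (v' * (1 - v')) = m * ((v - v') * (1 - v - v')) := by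
      ring
    have e2 : (m : ℝ) * v - m * v' = m * (v - v') := by ring
    rw [e1, e2, abs_mul, abs_mul, abs_mul, abs_of_pos hm']
    have : |1 - v - v'| ≤ 1 := by
      rw [abs_le]
      constructor <;> linarith [hv.1, hv.2, hv'.1, hv'.2]
    have h3 := abs_nonneg (v - v')
    nlinarith [mul_le_mul_of_nonneg_left this h3]

end RDE

/-! ### Concentration of the number of exchanges -/

/-- A sum over a subset `S` of nearly centred exchangeable bounded variables has a second moment
of order `|S|`: since the sum over all variables is bounded, two distinct ones cannot be
positively correlated by much. -/
theorem sum_mul_sq_le_of_exchangeable {Ω ι : Type*} [Fintype Ω] [DecidableEq ι] {w : Ω → ℝ}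
    (hw : ∀ ω, 0 ≤ w ω) {V S : Finset ι} (hSV : S ⊆ V) (a : Ω → ι → ℝ)
    (h1 : ∀ ω, w ω ≠ 0 → ∀ v ∈ V, |a ω v| ≤ 1) (h2 : ∀ ω, w ω ≠ 0 → |∑ v ∈ V, a ω v| ≤ 2)
    (hex : ∀ v ∈ V, ∀ u ∈ V, ∀ u' ∈ V, u ≠ v → u' ≠ v →
      ∑ ω, w ω * (a ω v * a ω u) = ∑ ω, w ω * (a ω v * a ω u')) :
    ∑ ω, w ω * (∑ v ∈ S, a ω v) ^ 2 ≤ 3 * S.card * ∑ ω, w ω := by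
  have hW : 0 ≤ ∑ ω, w ω := Finset.sum_nonneg fun ω _ => hw ω
  have e1 : ∑ ω, w ω * (∑ v ∈ S, a ω v) ^ 2 =
      ∑ v ∈ S, ∑ u ∈ S, ∑ ω, w ω * (a ω v * a ω u) := by
    have : ∀ ω, w ω * (∑ v ∈ S, a ω v) ^ 2 = ∑ v ∈ S, ∑ u ∈ S, w ω * (a ω v * a ω u) := by
      intro ω
      rw [pow_two, Finset.sum_mul_sum, Finset.mul_sum]
      exact Finset.sum_congr rfl fun v _ => Finset.mul_sum ..
    rw [Finset.sum_congr rfl fun ω _ => this ω, Finset.sum_comm]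
    exact Finset.sum_congr rfl fun v _ => Finset.sum_comm
  have e2 : ∀ v ∈ S, ∑ u ∈ S, ∑ ω, w ω * (a ω v * a ω u) ≤ 3 * ∑ ω, w ω := by
    intro v hv
    rw [← Finset.add_sum_erase _ _ hv]
    have h3 : ∑ ω, w ω * (a ω v * a ω v) ≤ ∑ ω, w ω := by
      refine Finset.sum_le_sum fun ω _ => ?_
      rcases eq_or_ne (w ω) 0 with h | h
      · simp [h]
      have := abs_le.1 (h1 ω h v (hSV hv))
      exact mul_le_of_le_one_right (hw ω) (by nlinarith)
    have h4 : ∑ u ∈ S.erase v, ∑ ω, w ω * (a ω v * a ω u) ≤ 2 * ∑ ω, w ω := by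
      rcases (S.erase v).eq_empty_or_nonempty with h | ⟨u₀, hu₀⟩
      · rw [h, Finset.sum_empty]; positivity
      set β := ∑ ω, w ω * (a ω v * a ω u₀) with hβ
      have h5 : ∀ u ∈ V.erase v, ∑ ω, w ω * (a ω v * a ω u) = β := fun u hu =>
        hex v (hSV hv) u (Finset.mem_of_mem_erase hu) u₀ (hSV (Finset.mem_of_mem_erase hu₀))
          (Finset.ne_of_mem_erase hu) (Finset.ne_of_mem_erase hu₀)
      have hsub := Finset.erase_subset_erase v hSV
      rw [Finset.sum_congr rfl fun u hu => h5 u (hsub hu), Finset.sum_const, nsmul_eq_mul]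
      rcases le_or_gt β 0 with h6 | h6
      · have : (((S.erase v).card : ℕ) : ℝ) * β ≤ 0 :=
          mul_nonpos_of_nonneg_of_nonpos (Nat.cast_nonneg _) h6
        linarith
      have h7 : ((V.erase v).card : ℝ) * β ≤ 2 * ∑ ω, w ω := by
        rw [← nsmul_eq_mul, ← Finset.sum_const, ← Finset.sum_congr rfl h5, Finset.sum_comm,
          Finset.mul_sum]
        refine Finset.sum_le_sum fun ω _ => ?_
        rcases eq_or_ne (w ω) 0 with h | h
        · simp [h]
        rw [← Finset.mul_sum, ← Finset.mul_sum, mul_comm 2,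
          Finset.sum_erase_eq_sub (hSV hv)]
        refine mul_le_mul_of_nonneg_left ?_ (hw ω)
        have h8 : a ω v * ∑ u ∈ V, a ω u ≤ 1 * 2 := by
          refine (le_abs_self _).trans ?_
          rw [abs_mul]
          exact mul_le_mul (h1 ω h v (hSV hv)) (h2 ω h) (abs_nonneg _) zero_le_one
        nlinarith [mul_self_nonneg (a ω v)]
      refine le_trans ?_ h7
      gcongr
    linarith
  rw [e1]
  refine (Finset.sum_le_sum e2).trans ?_
  rw [Finset.sum_const, nsmul_eq_mul]
  exact le_of_eq (by ring)

/-- The indicator that the key `v` is at one of the positions `k, …, m - 1` of the array. -/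
noncomputable def lateIndicator (B : ℕ → ℕ) (k m v : ℕ) : ℝ :=
  if ∃ q ∈ Finset.Ico k m, B q = v then 1 else 0

theorem sum_lateIndicator {B : ℕ → ℕ} {m k : ℕ} (hB : Set.InjOn B (Set.Iio m)) (s : Finset ℕ) :
    ∑ v ∈ s, lateIndicator B k m v = (((Finset.Ico k m).filter fun q => B q ∈ s).card : ℝ) := by
  simp only [lateIndicator]
  rw [Finset.sum_boole, ← Finset.card_image_of_injOn
    (s := (Finset.Ico k m).filter fun q => B q ∈ s) (f := B)]
  · congr 2
    ext v
    simp only [Finset.mem_filter, Finset.mem_image]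
    constructor
    · rintro ⟨hv, q, hq, rfl⟩
      exact ⟨q, ⟨hq, hv⟩, rfl⟩
    · rintro ⟨q, ⟨hq, hv⟩, rfl⟩
      exact ⟨hv, q, hq, rfl⟩
  · intro p hp q hq h
    simp only [Finset.coe_filter, Finset.mem_Ico, Set.mem_ofPred_eq] at hp hq
    exact hB hp.1.2 hq.1.2 h

theorem lateIndicator_swap (B : ℕ → ℕ) (k m u u' v : ℕ) :
    lateIndicator (Equiv.swap u u' ∘ B) k m v = lateIndicator B k m (Equiv.swap u u' v) := by
  unfold lateIndicator
  simp only [Function.comp_apply, Equiv.swap_apply_eq_iff]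

theorem lateIndicator_mem_Icc (B : ℕ → ℕ) (k m v : ℕ) :
    0 ≤ lateIndicator B k m v ∧ lateIndicator B k m v ≤ 1 := by
  unfold lateIndicator
  split_ifs <;> norm_num

namespace IsMinExchangeable

variable {Ω : Type} [Fintype Ω] {w : Ω → ℝ} {A : Ω → ℕ → ℕ} {m c : ℕ}

theorem ite_nonneg (h : IsMinExchangeable w A m c) (p : Ω → Prop) [DecidablePred p] (ω : Ω) :
    0 ≤ if p ω then w ω else 0 := by
  split_ifs
  · exact h.nonneg ω
  · exact le_rfl

/-- Given that the pivot has rank `k` (counted from zero), the number of exchanges is within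
`O(√m)` of `k (m - k) / m` in mean. -/
theorem sum_abs_exchanges_sub_le (h : IsMinExchangeable w A m c) {k : ℕ} (hk : 1 ≤ k)
    (hkm : k < m) :
    ∑ ω, (if A ω 0 = c + k then w ω else 0) *
        |((hoarePartition (A ω) m).exchanges : ℝ) - k * (m - k) / m| ≤
      4 * √m * ∑ ω, if A ω 0 = c + k then w ω else 0 := by
  set w' : Ω → ℝ := fun ω => if A ω 0 = c + k then w ω else 0 with hw'
  have hw0 : ∀ ω, 0 ≤ w' ω := fun ω =>
    h.ite_nonneg (fun ω => A ω 0 = c + k) ω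
  have hwne : ∀ ω, w' ω ≠ 0 → A ω 0 = c + k ∧
      Set.BijOn (A ω) (Set.Iio m) (Set.Ico c (c + m)) := fun ω hω => by
    have h1 : A ω 0 = c + k := by by_contra hc; simp [hw', hc] at hω
    exact ⟨h1, h.bijOn ω (by simpa [hw', h1] using hω)⟩
  have hmpos : (0 : ℝ) < m := by
    have : 0 < m := by omega
    exact_mod_cast this
  have hkm' : (k : ℝ) + 1 ≤ m := by exact_mod_cast hkm
  have hk0 : (1 : ℝ) ≤ k := by exact_mod_cast hk
  set s : ℝ := (m - k) / m with hs
  have hs0 : 0 ≤ s := div_nonneg (by linarith) hmpos.le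
  have hs1 : s ≤ 1 := (div_le_one hmpos).2 (by linarith)
  have hsm : m * s = m - k := by rw [hs]; field_simp
  set V := (Finset.Ioo c (c + m)).erase (c + k) with hV
  set S := Finset.Ioo c (c + k) with hS
  set a : Ω → ℕ → ℝ := fun ω v => lateIndicator (A ω) k m v - s with ha
  have hSV : S ⊆ V := fun v hv => by
    simp only [hS, hV, Finset.mem_Ioo, Finset.mem_erase] at hv ⊢
    omega
  have hSc : (S.card : ℝ) ≤ k - 1 := by
    rw [hS, Nat.card_Ioo, Nat.add_sub_cancel_left, Nat.cast_sub hk, Nat.cast_one]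
  have hckm : c + k ∈ Finset.Ioo c (c + m) := Finset.mem_Ioo.2 ⟨by omega, by omega⟩
  have hpiv : ∀ ω, w' ω ≠ 0 → lateIndicator (A ω) k m (c + k) = 0 := fun ω hω => by
    obtain ⟨h0, hb⟩ := hwne ω hω
    rw [lateIndicator, if_neg]
    rintro ⟨q, hq, hq'⟩
    rw [Finset.mem_Ico] at hq
    have := hb.injOn (show q < m from hq.2) (show 0 < m by omega) (hq'.trans h0.symm)
    omega
  have hsecond := sum_mul_sq_le_of_exchangeable hw0 hSV a
    (fun ω _ v _ => by
      have := lateIndicator_mem_Icc (A ω) k m v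
      simp only [ha]
      rw [abs_le]
      constructor <;> linarith [this.1, this.2])
    (fun ω hω => by
      obtain ⟨h0, hb⟩ := hwne ω hω
      have e1 := sum_lateIndicator (k := k) hb.injOn (Finset.Ico c (c + m))
      rw [Finset.filter_true_of_mem fun q hq => by
        rw [Finset.mem_Ico] at hq
        exact Finset.mem_Ico.2 (hb.mapsTo (show q ∈ Set.Iio m from hq.2)),
        ← Finset.Ioo_insert_left (by omega), Finset.sum_insert Finset.left_notMem_Ioo,
        ← Finset.add_sum_erase _ _ hckm, hpiv ω hω, ← hV, Nat.card_Ico,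
        Nat.cast_sub hkm.le] at e1
      have e2 : (V.card : ℝ) = m - 2 := by
        rw [hV, Finset.card_erase_of_mem hckm, Nat.card_Ioo, Nat.add_sub_cancel_left,
          Nat.sub_sub, Nat.cast_sub (by omega)]
        norm_num
      simp only [ha]
      rw [Finset.sum_sub_distrib, Finset.sum_const, nsmul_eq_mul, e2]
      have := lateIndicator_mem_Icc (A ω) k m c
      rw [abs_le]
      constructor <;> linarith [this.1, this.2])
    (by
      intro v hv u hu u' hu' hne hne'
      simp only [hV, Finset.mem_erase, Finset.mem_Ioo] at hv hu hu'
      have := h.swap (a := u) (b := u') hu.2 hu'.2 fun B => if B 0 = c + k then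
        (lateIndicator B k m v - s) * (lateIndicator B k m u' - s) else 0
      simp only [lateIndicator_swap, Function.comp_apply, Equiv.swap_apply_right,
        Equiv.swap_apply_of_ne_of_ne hne.symm hne'.symm, Equiv.swap_apply_eq_iff,
        Equiv.swap_apply_of_ne_of_ne hu.1.symm hu'.1.symm] at this
      simpa only [hw', ha, ite_mul, zero_mul, mul_ite, mul_zero] using this)
  have hT : ∀ ω, w' ω ≠ 0 →
      (((hoarePartition (A ω) m).exchanges : ℝ) - k * (m - k) / m) ^ 2 ≤
        2 * (∑ v ∈ S, a ω v) ^ 2 + 2 := by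
    intro ω hω
    obtain ⟨h0, hb⟩ := hwne ω hω
    have e1 := sum_lateIndicator (k := k) hb.injOn (Finset.Ico c (c + k))
    have e2 : ((Finset.Ico k m).filter fun q => A ω q ∈ Finset.Ico c (c + k)) =
        (Finset.range m).filter fun q => k ≤ q ∧ A ω q < c + k := by
      ext q
      simp only [Finset.mem_filter, Finset.mem_Ico, Finset.mem_range]
      constructor
      · rintro ⟨h1, h2⟩; exact ⟨h1.2, h1.1, h2.2⟩
      · rintro ⟨h1, h2, h3⟩
        exact ⟨⟨h2, h1⟩, (hb.mapsTo (show q ∈ Set.Iio m from h1)).1, h3⟩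
    rw [e2, ← (hoarePartition_spec (A ω) hb h0 hk hkm).2.2.2,
      ← Finset.Ioo_insert_left (by omega), Finset.sum_insert Finset.left_notMem_Ioo] at e1
    have e3 : ∑ v ∈ S, a ω v = ∑ v ∈ S, lateIndicator (A ω) k m v - (k - 1) * s := by
      simp only [ha]
      rw [Finset.sum_sub_distrib, Finset.sum_const, nsmul_eq_mul, hS, Nat.card_Ioo,
        Nat.add_sub_cancel_left, Nat.cast_sub hk, Nat.cast_one]
    have e4 : (k : ℝ) * (m - k) / m = k * s := by rw [hs, mul_div_assoc]
    have hc := lateIndicator_mem_Icc (A ω) k m c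
    have e5 : ((hoarePartition (A ω) m).exchanges : ℝ) - k * (m - k) / m =
        ∑ v ∈ S, a ω v + (lateIndicator (A ω) k m c - s) := by
      rw [e4, e3, ← e1]; ring
    rw [e5]
    generalize ∑ v ∈ S, a ω v = x
    have h6 : (lateIndicator (A ω) k m c - s) ^ 2 ≤ 1 := by
      rw [sq_le_one_iff_abs_le_one, abs_le]
      constructor <;> linarith [hc.1, hc.2]
    nlinarith [sq_nonneg (x - (lateIndicator (A ω) k m c - s))]
  have hsq : √(m : ℝ) ^ 2 = m := Real.sq_sqrt hmpos.le
  have hsqpos : 0 < √(m : ℝ) := Real.sqrt_pos.2 hmpos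
  have hW : 0 ≤ ∑ ω, w' ω := Finset.sum_nonneg fun ω _ => hw0 ω
  -- the bound `2 |x| √m ≤ x ^ 2 + m` replaces the Cauchy-Schwarz inequality
  have hfin : ∀ ω, w' ω * |((hoarePartition (A ω) m).exchanges : ℝ) - k * (m - k) / m| ≤
      1 / √m * (w' ω * (∑ v ∈ S, a ω v) ^ 2) + (1 / √m + √m / 2) * w' ω := by
    intro ω
    rcases eq_or_ne (w' ω) 0 with h1 | h1
    · simp [h1]
    have h2 := hT ω h1
    generalize ((hoarePartition (A ω) m).exchanges : ℝ) - k * (m - k) / m = y at h2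
    generalize ∑ v ∈ S, a ω v = x at h2
    have h3 : |y| ≤ 1 / √m * x ^ 2 + (1 / √m + √m / 2) := by
      have h4 : 0 ≤ (|y| - √m) ^ 2 := sq_nonneg _
      rw [sub_sq, sq_abs] at h4
      have h5 : |y| * √m ≤ (1 / √m * x ^ 2 + (1 / √m + √m / 2)) * √m := by
        have : (1 / √(m : ℝ) * x ^ 2 + (1 / √m + √m / 2)) * √m = x ^ 2 + 1 + √m ^ 2 / 2 := by
          field_simp
          ring
        rw [this]
        nlinarith
      exact le_of_mul_le_mul_right h5 hsqpos
    have := mul_le_mul_of_nonneg_left h3 (hw0 ω)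
    nlinarith
  refine (Finset.sum_le_sum fun ω _ => hfin ω).trans ?_
  rw [Finset.sum_add_distrib, ← Finset.mul_sum, ← Finset.mul_sum]
  have h6 : 1 / √(m : ℝ) * ∑ ω, w' ω * (∑ v ∈ S, a ω v) ^ 2 ≤
      1 / √m * (3 * (k - 1) * ∑ ω, w' ω) := by
    refine mul_le_mul_of_nonneg_left (hsecond.trans ?_) (by positivity)
    gcongr
  have h7 : 1 / √(m : ℝ) * (3 * (k - 1)) + (1 / √m + √m / 2) ≤ 4 * √m := by
    refine le_of_mul_le_mul_right ?_ hsqpos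
    have : (1 / √(m : ℝ) * (3 * (k - 1)) + (1 / √m + √m / 2)) * √m =
        3 * (k - 1) + 1 + √m ^ 2 / 2 := by
      field_simp
      ring
    rw [this, mul_assoc, ← pow_two, hsq]
    linarith
  have := mul_le_mul_of_nonneg_right h7 hW
  linarith

end IsMinExchangeable

/-! ### The recursion for the distance to the limit law -/

/-- A bound that holds after conditioning on each value of `T` holds for the whole sum. -/
theorem abs_sum_le_of_forall_fiber {Ω : Type*} [Fintype Ω] {w : Ω → ℝ} {T : Ω → ℕ}
    {Φ : Ω → ℕ → ℝ} {b : ℝ} (h : ∀ t, |∑ ω, (if T ω = t then w ω else 0) * Φ ω t| ≤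
      b * ∑ ω, if T ω = t then w ω else 0) :
    |∑ ω, w ω * Φ ω (T ω)| ≤ b * ∑ ω, w ω := by
  have e1 : ∀ ψ : Ω → ℕ → ℝ, ∑ ω, w ω * ψ ω (T ω) =
      ∑ t ∈ Finset.univ.image T, ∑ ω, (if T ω = t then w ω else 0) * ψ ω t := fun ψ => by
    rw [Finset.sum_comm]
    refine Finset.sum_congr rfl fun ω _ => ?_
    simp only [ite_mul, zero_mul]
    rw [Finset.sum_ite_eq, if_pos (Finset.mem_image_of_mem T (Finset.mem_univ ω))]
  have e2 : ∑ ω, w ω = ∑ t ∈ Finset.univ.image T, ∑ ω, if T ω = t then w ω else 0 := by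
    simpa using e1 fun _ _ => 1
  rw [e1, e2, Finset.mul_sum]
  exact (Finset.abs_sum_le_sum_abs _ _).trans (Finset.sum_le_sum fun t _ => h t)

/-- Size-biasing contracts the rate `√m`: the mean of `√k` with weights `2 k / (m (m - 1))` is at
most `49 / 60 * √m`. -/
theorem sum_mul_sqrt_le {m : ℕ} (hm : 2 ≤ m) :
    ∑ j ∈ Finset.range (m - 1), 2 * ((j : ℝ) + 1) * √((j : ℝ) + 1) ≤
      m * (m - 1) * (49 / 60 * √m) := by
  have hm' : (2 : ℝ) ≤ m := by exact_mod_cast hm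
  have hs : 0 < √(m : ℝ) := Real.sqrt_pos.2 (by linarith)
  have hsq : √(m : ℝ) ^ 2 = m := Real.sq_sqrt (by linarith)
  -- the tangent of the square root at a point near its mean
  have h1 : ∀ j ∈ Finset.range (m - 1), 2 * ((j : ℝ) + 1) * √((j : ℝ) + 1) ≤
      2 * ((j : ℝ) + 1) * (5 / 8 * (j + 1) / √m + 2 / 5 * √m) := by
    intro j _
    refine mul_le_mul_of_nonneg_left ?_ (by positivity)
    have h2 : √((j : ℝ) + 1) ^ 2 = j + 1 := Real.sq_sqrt (by positivity)
    refine le_of_mul_le_mul_right ?_ hs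
    have : (5 / 8 * ((j : ℝ) + 1) / √m + 2 / 5 * √m) * √m =
        5 / 8 * √((j : ℝ) + 1) ^ 2 + 2 / 5 * √m ^ 2 := by
      rw [h2]
      field_simp
    rw [this]
    nlinarith [sq_nonneg (5 * √((j : ℝ) + 1) - 4 * √(m : ℝ))]
  refine (Finset.sum_le_sum h1).trans ?_
  have h3 : ∀ n : ℕ, ∑ j ∈ Finset.range n, 2 * ((j : ℝ) + 1) *
      (5 / 8 * (j + 1) / √m + 2 / 5 * √m) =
      5 / 24 * (n * (n + 1) * (2 * n + 1)) / √m + 2 / 5 * (n * (n + 1)) * √m := by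
    intro n
    induction n with
    | zero => simp
    | succ n ih =>
      rw [Finset.sum_range_succ, ih]
      push_cast
      field_simp
      ring
  rw [h3, Nat.cast_sub (by omega), Nat.cast_one]
  refine le_of_mul_le_mul_right ?_ hs
  have : (5 / 24 * (((m : ℝ) - 1) * (m - 1 + 1) * (2 * (m - 1) + 1)) / √m +
      2 / 5 * ((m - 1) * (m - 1 + 1)) * √m) * √m =
      5 / 24 * (((m : ℝ) - 1) * (m - 1 + 1) * (2 * (m - 1) + 1)) +
      2 / 5 * ((m - 1) * (m - 1 + 1)) * √m ^ 2 := by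
    field_simp
  rw [this, show (m : ℝ) * (m - 1) * (49 / 60 * √m) * √m = m * (m - 1) * (49 / 60) * √m ^ 2 by ring,
    hsq]
  nlinarith

theorem sum_range_add_reflect (f : ℝ → ℝ) {m : ℕ} (hm : 1 ≤ m) :
    ∑ j ∈ Finset.range (m - 1), (f (j + 1) + f (m - (j + 1))) =
      ∑ j ∈ Finset.range (m - 1), 2 * f (j + 1) := by
  have h1 := Finset.sum_range_reflect (fun j : ℕ => f (j + 1)) (m - 1)
  have h2 : ∀ j ∈ Finset.range (m - 1), f (m - (j + 1)) = f ((m - 1 - 1 - j : ℕ) + 1) := by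
    intro j hj
    rw [Finset.mem_range] at hj
    congr 1
    have : m - 1 - 1 - j + 1 + (j + 1) = m := by omega
    have : ((m - 1 - 1 - j : ℕ) : ℝ) + 1 + (j + 1) = m := by exact_mod_cast this
    linarith
  rw [Finset.sum_add_distrib, Finset.sum_congr rfl h2, h1, ← Finset.mul_sum, two_mul]

namespace IsMinExchangeable

variable {Ω : Type} [Fintype Ω]

/-- The bound for arrays of size `n` that is proved by induction: up to normalization, the
distance between the law of the number of exchanges and the law of `n X`, tested against
1-Lipschitz functions, is at most `60 √n`, plus a penalty for the probability that the first entry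
is the smallest one, in which case the first step does not reduce the size by a factor. -/
def DistanceBound (Ω : Type) [Fintype Ω] (ν : Measure ℝ) (n : ℕ) : Prop :=
  ∀ (w : Ω → ℝ) (A : Ω → ℕ → ℕ) (c : ℕ), IsMinExchangeable w A n c →
    ∀ g : ℝ → ℝ, LipschitzWith 1 g →
      |∑ ω, w ω * (∑ r ∈ Finset.range n, g (quickselectExchanges (A ω) n (r + 1)) -
        n * ∫ x, g (n * x) ∂ν)| ≤
      n * (60 * √n * ∑ ω, w ω + 4 * ∑ ω, if A ω 0 = c then w ω else 0)

variable {w : Ω → ℝ} {A : Ω → ℕ → ℕ} {m c : ℕ} {ν : Measure ℝ} [IsProbabilityMeasure ν]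

theorem sum_ite_le (h : IsMinExchangeable w A m c) (p : Ω → Prop) [DecidablePred p] :
    ∑ ω, (if p ω then w ω else 0) ≤ ∑ ω, w ω := by
  refine Finset.sum_le_sum fun ω _ => ?_
  split_ifs
  · exact le_rfl
  · exact h.nonneg ω

/-- The contribution of the event that the pivot is not the smallest key and has rank `k`. -/
theorem abs_sum_pivot_le (h01 : ∀ᵐ x ∂ν, x ∈ Set.Icc (0 : ℝ) 1)
    (h : IsMinExchangeable w A m c) {k : ℕ} (hk : 1 ≤ k) (hkm : k < m)
    (ih1 : DistanceBound Ω ν k) (ih2 : DistanceBound Ω ν (m - k)) {g : ℝ → ℝ}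
    (hg : LipschitzWith 1 g) :
    |∑ ω, (if A ω 0 = c + k then w ω else 0) *
        (∑ r ∈ Finset.range m, g (quickselectExchanges (A ω) m (r + 1)) -
          (k * ∫ x, g (k * (m - k) / m + k * x) ∂ν +
            (m - k) * ∫ x, g (k * (m - k) / m + (m - k) * x) ∂ν))| ≤
      (k * (60 * √k + 4) + (m - k) * (60 * √(m - k) + 4) + 4 * m * √m) *
        ∑ ω, if A ω 0 = c + k then w ω else 0 := by
  have hmk : ((m - k : ℕ) : ℝ) = m - k := Nat.cast_sub hkm.le
  have hkm0 : (0 : ℝ) ≤ m - k := by rw [← hmk]; positivity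
  set w' : Ω → ℝ := fun ω => if A ω 0 = c + k then w ω else 0 with hw'
  have hw0 : ∀ ω, 0 ≤ w' ω := fun ω => h.ite_nonneg (fun ω => A ω 0 = c + k) ω
  set T : Ω → ℕ := fun ω => (hoarePartition (A ω) m).exchanges with hT
  set e : ℝ → ℝ → ℝ := fun a s => ∫ x, g (a + s * x) ∂ν with he
  have hlip : ∀ a b s, |e a s - e b s| ≤ |a - b| := fun a b s => by
    simpa using abs_integral_sub_le h01 hg a b s s
  set ΦL : Ω → ℕ → ℝ := fun ω t => ∑ r ∈ Finset.range k, g (t +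
    quickselectExchanges (hoarePartition (A ω) m).array k (r + 1)) - k * e t k with hΦL
  set ΦR : Ω → ℕ → ℝ := fun ω t => ∑ r ∈ Finset.range (m - k), g (t +
    quickselectExchanges (fun q => (hoarePartition (A ω) m).array (k + q)) (m - k) (r + 1)) -
      (m - k) * e t (m - k) with hΦR
  have hcond : ∀ t ω, (if A ω 0 = c + k ∧ (hoarePartition (A ω) m).exchanges = t then w ω else 0) =
      if T ω = t then w' ω else 0 := fun t ω => by
    by_cases h1 : A ω 0 = c + k <;> by_cases h2 : T ω = t <;> simp_all
  have hshift : ∀ t : ℕ, LipschitzWith 1 fun y => g (t + y) := fun t => by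
    have : LipschitzWith 1 fun y : ℝ => (t : ℝ) + y :=
      LipschitzWith.of_dist_le_mul fun x y => by simp
    simpa [Function.comp_def] using hg.comp this
  have hL : |∑ ω, w' ω * ΦL ω (T ω)| ≤ k * (60 * √k + 4) * ∑ ω, w' ω := by
    refine abs_sum_le_of_forall_fiber fun t => ?_
    have hl := h.left hk hkm t
    have h1 := ih1 _ _ _ hl (fun y => g (t + y)) (hshift t)
    have h2 := hl.sum_ite_le fun ω => (hoarePartition (A ω) m).array 0 = c
    simp only [hcond] at h1 h2
    refine h1.trans ?_
    linarith [mul_le_mul_of_nonneg_left h2 (Nat.cast_nonneg (α := ℝ) k)]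
  have hR : |∑ ω, w' ω * ΦR ω (T ω)| ≤ (m - k) * (60 * √(m - k) + 4) * ∑ ω, w' ω := by
    refine abs_sum_le_of_forall_fiber fun t => ?_
    have hr := h.right hk hkm t
    have h1 := ih2 _ _ _ hr (fun y => g (t + y)) (hshift t)
    have h2 := hr.sum_ite_le fun ω => (hoarePartition (A ω) m).array (k + 0) = c + k
    simp only [hcond, hmk] at h1 h2
    refine h1.trans ?_
    linarith [mul_le_mul_of_nonneg_left h2 hkm0]
  have hE : |∑ ω, w' ω * (k * (e (T ω) k - e (k * (m - k) / m) k) +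
      (m - k) * (e (T ω) (m - k) - e (k * (m - k) / m) (m - k)))| ≤
      4 * m * √m * ∑ ω, w' ω := by
    have h1 := h.sum_abs_exchanges_sub_le hk hkm
    have h2 : ∀ ω, |w' ω * (k * (e (T ω) k - e (k * (m - k) / m) k) +
        (m - k) * (e (T ω) (m - k) - e (k * (m - k) / m) (m - k)))| ≤
        m * (w' ω * |(T ω : ℝ) - k * (m - k) / m|) := by
      intro ω
      rw [abs_mul, abs_of_nonneg (hw0 ω)]
      have h3 : |k * (e (T ω) k - e (k * (m - k) / m) k) +
          (m - k) * (e (T ω) (m - k) - e (k * (m - k) / m) (m - k))| ≤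
          k * |(T ω : ℝ) - k * (m - k) / m| + (m - k) * |(T ω : ℝ) - k * (m - k) / m| := by
        refine (abs_add_le _ _).trans ?_
        rw [abs_mul, abs_mul, abs_of_nonneg hkm0, Nat.abs_cast]
        exact add_le_add (mul_le_mul_of_nonneg_left (hlip _ _ _) (Nat.cast_nonneg k))
          (mul_le_mul_of_nonneg_left (hlip _ _ _) hkm0)
      refine (mul_le_mul_of_nonneg_left h3 (hw0 ω)).trans (le_of_eq (by ring))
    refine (Finset.abs_sum_le_sum_abs _ _).trans ((Finset.sum_le_sum fun ω _ => h2 ω).trans ?_)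
    rw [← Finset.mul_sum, show 4 * (m : ℝ) * √m * ∑ ω, w' ω = m * (4 * √m * ∑ ω, w' ω) by ring]
    exact mul_le_mul_of_nonneg_left h1 (Nat.cast_nonneg m)
  have hsplit : ∑ ω, w' ω * (∑ r ∈ Finset.range m, g (quickselectExchanges (A ω) m (r + 1)) -
      (k * e (k * (m - k) / m) k + (m - k) * e (k * (m - k) / m) (m - k))) =
      ∑ ω, w' ω * ΦL ω (T ω) + ∑ ω, w' ω * ΦR ω (T ω) +
      ∑ ω, w' ω * (k * (e (T ω) k - e (k * (m - k) / m) k) +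
      (m - k) * (e (T ω) (m - k) - e (k * (m - k) / m) (m - k))) := by
    rw [← Finset.sum_add_distrib, ← Finset.sum_add_distrib]
    refine Finset.sum_congr rfl fun ω _ => ?_
    rcases eq_or_ne (w' ω) 0 with h1 | h1
    · simp [h1]
    have h0 : A ω 0 = c + k := by by_contra hc; simp [hw', hc] at h1
    have hb := h.bijOn ω (by simpa [hw', h0] using h1)
    rw [sum_quickselectExchanges hb h0 hk hkm fun y => g y]
    simp only [hΦL, hΦR, hT]
    push_cast
    ring
  rw [hsplit, add_mul, add_mul]
  exact (abs_add_le _ _).trans (add_le_add ((abs_add_le _ _).trans (add_le_add hL hR)) hE)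

/-- The contribution of the event that the pivot is the smallest key. Then the remaining entries
are in uniformly random order, so that the penalty in the bound for them is small. -/
theorem abs_sum_min_le (h01 : ∀ᵐ x ∂ν, x ∈ Set.Icc (0 : ℝ) 1)
    (h : IsMinExchangeable w A m c) (hm : 2 ≤ m) (ih : DistanceBound Ω ν (m - 1)) {g : ℝ → ℝ}
    (hg : LipschitzWith 1 g) :
    |∑ ω, (if A ω 0 = c then w ω else 0) *
        (∑ r ∈ Finset.range m, g (quickselectExchanges (A ω) m (r + 1)) -
          m * ∫ x, g (m * x) ∂ν)| ≤
      m * (60 * √m + 4) * ∑ ω, if A ω 0 = c then w ω else 0 := by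
  have hm1 : ((m - 1 : ℕ) : ℝ) = m - 1 := by rw [Nat.cast_sub (by omega), Nat.cast_one]
  have hm' : (2 : ℝ) ≤ m := by exact_mod_cast hm
  set w' : Ω → ℝ := fun ω => if A ω 0 = c then w ω else 0 with hw'
  have hw0 : ∀ ω, 0 ≤ w' ω := fun ω => h.ite_nonneg (fun ω => A ω 0 = c) ω
  have hW : 0 ≤ ∑ ω, w' ω := Finset.sum_nonneg fun ω _ => hw0 ω
  have h1 := ih _ _ _ (h.tail hm) g hg
  have h2 := h.second_weight hm
  simp only [add_zero, hm1] at h1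
  set E : ℝ := ∫ x, g (m * x) ∂ν with hE
  set E' : ℝ := ∫ x, g ((m - 1) * x) ∂ν with hE'
  have h3 : |g 0 - E| ≤ m := by
    have := abs_integral_sub_le h01 hg 0 0 0 m
    simpa using this
  have h4 : |E' - E| ≤ 1 := by
    have := abs_integral_sub_le h01 hg 0 0 (m - 1) m
    simpa using this
  have hsplit : ∑ ω, w' ω * (∑ r ∈ Finset.range m, g (quickselectExchanges (A ω) m (r + 1)) -
      m * E) =
      ∑ ω, w' ω * (∑ r ∈ Finset.range (m - 1), g (quickselectExchanges (fun q => A ω (1 + q))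
        (m - 1) (r + 1)) - (m - 1) * E') + (∑ ω, w' ω) * ((g 0 - E) + (m - 1) * (E' - E)) := by
    rw [Finset.sum_mul, ← Finset.sum_add_distrib]
    refine Finset.sum_congr rfl fun ω _ => ?_
    rcases eq_or_ne (w' ω) 0 with h1 | h1
    · simp [h1]
    have h0 : A ω 0 = c := by by_contra hc; simp [hw', hc] at h1
    have hb := h.bijOn ω (by simpa [hw', h0] using h1)
    rw [sum_quickselectExchanges_of_min hm hb h0 fun y => g y]
    push_cast
    ring
  rw [hsplit]
  refine (abs_add_le _ _).trans ?_
  have h5 : |(∑ ω, w' ω) * ((g 0 - E) + (m - 1) * (E' - E))| ≤ (∑ ω, w' ω) * (m + (m - 1) * 1) := by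
    rw [abs_mul, abs_of_nonneg hW]
    refine mul_le_mul_of_nonneg_left ((abs_add_le _ _).trans (add_le_add h3 ?_)) hW
    rw [abs_mul, abs_of_nonneg (by linarith : (0 : ℝ) ≤ m - 1)]
    exact mul_le_mul_of_nonneg_left h4 (by linarith)
  have h6 : √((m : ℝ) - 1) ≤ √m := Real.sqrt_le_sqrt (by linarith)
  have h7 : ((m : ℝ) - 1) * (60 * √(m - 1) * ∑ ω, w' ω) ≤ m * (60 * √m * ∑ ω, w' ω) := by
    gcongr
    linarith
  have h8 := add_le_add h1 h5
  rw [mul_add ((m : ℝ) - 1), mul_left_comm _ (4 : ℝ), h2] at h8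
  have h9 := mul_le_mul_of_nonneg_right hm' hW
  nlinarith

theorem distanceBound (h01 : ∀ᵐ x ∂ν, x ∈ Set.Icc (0 : ℝ) 1) (hR : IsRDESolution ν) {m : ℕ}
    (hm : 1 ≤ m) : DistanceBound Ω ν m := by
  induction m using Nat.strong_induction_on with
  | _ m ih =>
    intro w A c h g hg
    have hW : 0 ≤ ∑ ω, w ω := Finset.sum_nonneg fun ω _ => h.nonneg ω
    set α : ℝ := ∑ ω, if A ω 0 = c then w ω else 0 with hα
    have hα0 : 0 ≤ α := Finset.sum_nonneg fun ω _ => h.ite_nonneg (fun ω => A ω 0 = c) ω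
    rcases eq_or_lt_of_le hm with rfl | hm
    · have h1 : |g 0 - ∫ x, g x ∂ν| ≤ 1 := by
        simpa using abs_integral_sub_le h01 hg 0 0 0 1
      simp only [quickselectExchanges_of_le_one _ le_rfl, Finset.range_one, Finset.sum_singleton,
        Nat.cast_zero, Nat.cast_one, one_mul, Real.sqrt_one, ← Finset.sum_mul]
      rw [abs_mul, abs_of_nonneg hW]
      nlinarith [mul_le_mul_of_nonneg_left h1 hW]
    have hm' : (2 : ℝ) ≤ m := by exact_mod_cast hm
    set S : Ω → ℝ := fun ω => ∑ r ∈ Finset.range m, g (quickselectExchanges (A ω) m (r + 1)) with hS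
    set E : ℝ := ∫ x, g (m * x) ∂ν with hE
    set β : ℝ := ∑ ω, if A ω 0 = c + 1 then w ω else 0 with hβ
    have hβ0 : 0 ≤ β := Finset.sum_nonneg fun ω _ => h.ite_nonneg (fun ω => A ω 0 = c + 1) ω
    have hβk : ∀ k, 1 ≤ k → k < m → (∑ ω, if A ω 0 = c + k then w ω else 0) = β := by
      intro k hk hkm
      have h1 := h.pivot_weight hk hkm
      rw [← h.pivot_weight le_rfl hm] at h1
      exact mul_left_cancel₀ (by linarith : (m : ℝ) - 1 ≠ 0) h1
    have hβα : (m - 1 : ℝ) * β = ∑ ω, w ω - α := h.pivot_weight le_rfl hm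
    set G : ℝ → ℝ := fun k => ∫ x, g (k * (m - k) / m + k * x) ∂ν with hG
    -- the cases of the rank of the pivot
    have hsplit : ∑ ω, w ω * (S ω - m * E) =
        ∑ ω, (if A ω 0 = c then w ω else 0) * (S ω - m * E) +
        ∑ j ∈ Finset.range (m - 1), ∑ ω, (if A ω 0 = c + (j + 1) then w ω else 0) *
          (S ω - m * E) := by
      rw [Finset.sum_comm, ← Finset.sum_add_distrib]
      refine Finset.sum_congr rfl fun ω _ => ?_
      rw [← Finset.sum_mul, ← add_mul]
      congr 1
      exact h.eq_sum_pivot (by omega) ω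
    have hpiv : ∀ j ∈ Finset.range (m - 1),
        |∑ ω, (if A ω 0 = c + (j + 1) then w ω else 0) * (S ω - m * E) -
          β * ((j + 1) * G (j + 1) + (m - (j + 1)) * G (m - (j + 1)) - m * E)| ≤
        (((j + 1) * (60 * √((j : ℝ) + 1) + 4) + (m - (j + 1)) * (60 * √((m : ℝ) - (j + 1)) + 4)) +
          4 * m * √m) * β := by
      intro j hj
      rw [Finset.mem_range] at hj
      have h1 := h.abs_sum_pivot_le h01 (k := j + 1) (by omega) (by omega)
        (ih _ (by omega) (by omega)) (ih _ (by omega) (by omega)) hg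
      rw [hβk (j + 1) (by omega) (by omega)] at h1
      push_cast at h1
      refine le_of_eq_of_le ?_ h1
      congr 1
      rw [← hβk (j + 1) (by omega) (by omega), Finset.sum_mul, ← Finset.sum_sub_distrib]
      refine Finset.sum_congr rfl fun ω _ => ?_
      rw [← mul_sub]
      congr 1
      simp only [hG, hS, sub_sub_cancel, mul_comm ((m : ℝ) - (j + 1)) ((j : ℝ) + 1)]
      ring
    have hm1 : (m : ℝ) - 1 ≠ 0 := by linarith
    have hD : |∑ j ∈ Finset.range (m - 1), β * ((j + 1) * G (j + 1) +
        (m - (j + 1)) * G (m - (j + 1)) - m * E)| ≤ m * (m - 1) * 2 * β := by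
      have h1 := hR.abs_sum_sub_integral_le h01 hg hm
      have hmm : (0 : ℝ) < m * (m - 1) := by nlinarith
      have h2 : ∑ j ∈ Finset.range (m - 1), β * ((j + 1) * G (j + 1) +
          (m - (j + 1)) * G (m - (j + 1)) - m * E) =
          m * (m - 1) * β * ((∑ j ∈ Finset.range (m - 1), 2 * ((j : ℝ) + 1) / (m * (m - 1)) *
            G (j + 1)) - E) := by
        rw [← Finset.mul_sum, Finset.sum_sub_distrib,
          sum_range_add_reflect (fun y => y * G y) (by omega : 1 ≤ m), Finset.sum_const,
          Finset.card_range, nsmul_eq_mul, Nat.cast_sub (by omega), Nat.cast_one]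
        have h3 : ∀ j ∈ Finset.range (m - 1), 2 * (((j : ℝ) + 1) * G (j + 1)) =
            m * (m - 1) * (2 * ((j : ℝ) + 1) / (m * (m - 1)) * G (j + 1)) := fun j _ => by
          field_simp
        rw [Finset.sum_congr rfl h3, ← Finset.mul_sum]
        ring
      rw [h2, abs_mul, abs_of_nonneg (by positivity)]
      calc m * (m - 1) * β * _ ≤ m * (m - 1) * β * 2 :=
            mul_le_mul_of_nonneg_left h1 (by positivity)
        _ = m * (m - 1) * 2 * β := by ring
    have hB : ∑ j ∈ Finset.range (m - 1), (((j + 1) * (60 * √((j : ℝ) + 1) + 4) +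
        (m - (j + 1)) * (60 * √((m : ℝ) - (j + 1)) + 4)) + 4 * m * √m) * β ≤
        m * (m - 1) * (53 * √m + 4) * β := by
      rw [← Finset.sum_mul, Finset.sum_add_distrib,
        sum_range_add_reflect (fun y => y * (60 * √y + 4)) (by omega : 1 ≤ m), Finset.sum_const,
        Finset.card_range, nsmul_eq_mul, Nat.cast_sub (by omega), Nat.cast_one]
      refine mul_le_mul_of_nonneg_right ?_ hβ0
      have h1 := sum_mul_sqrt_le hm
      have h2 : ∀ n : ℕ, ∑ j ∈ Finset.range n, 2 * (((j : ℝ) + 1) * (60 * √((j : ℝ) + 1) + 4)) =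
          60 * ∑ j ∈ Finset.range n, 2 * ((j : ℝ) + 1) * √((j : ℝ) + 1) +
            4 * (n * (n + 1)) := by
        intro n
        induction n with
        | zero => simp
        | succ n ih =>
          rw [Finset.sum_range_succ, Finset.sum_range_succ, ih]
          push_cast
          ring
      rw [h2, Nat.cast_sub (by omega), Nat.cast_one]
      linarith
    have hrest : |∑ j ∈ Finset.range (m - 1), ∑ ω, (if A ω 0 = c + (j + 1) then w ω else 0) *
        (S ω - m * E)| ≤ m * (m - 1) * (53 * √m + 6) * β := by
      have h1 := (Finset.abs_sum_le_sum_abs _ _).trans ((Finset.sum_le_sum hpiv).trans hB)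
      rw [Finset.sum_sub_distrib] at h1
      have h2 := abs_add_le (∑ j ∈ Finset.range (m - 1), ∑ ω,
        (if A ω 0 = c + (j + 1) then w ω else 0) * (S ω - m * E) -
        ∑ j ∈ Finset.range (m - 1), β * ((j + 1) * G (j + 1) +
        (m - (j + 1)) * G (m - (j + 1)) - m * E)) (∑ j ∈ Finset.range (m - 1), β * ((j + 1) *
        G (j + 1) + (m - (j + 1)) * G (m - (j + 1)) - m * E))
      rw [sub_add_cancel] at h2
      linarith
    have hmin := h.abs_sum_min_le h01 hm (ih _ (by omega) (by omega)) hg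
    have hs1 : 1 ≤ √(m : ℝ) := Real.one_le_sqrt.2 (by linarith)
    have hfin : (m : ℝ) * (m - 1) * (53 * √m + 6) * β ≤ m * (60 * √m) * (∑ ω, w ω - α) := by
      rw [← hβα, show (m : ℝ) * (m - 1) * (53 * √m + 6) * β =
        m * (53 * √m + 6) * ((m - 1) * β) by ring]
      refine mul_le_mul_of_nonneg_right ?_ (mul_nonneg (by linarith) hβ0)
      refine mul_le_mul_of_nonneg_left ?_ (by linarith)
      linarith
    change |∑ ω, w ω * (S ω - m * E)| ≤ _
    rw [hsplit]
    refine (abs_add_le _ _).trans ((add_le_add hmin (hrest.trans hfin)).trans (le_of_eq ?_))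
    ring

end IsMinExchangeable

/-! ### Existence of a solution of the distributional equation -/

instance isProbabilityMeasure_restrict_Icc :
    IsProbabilityMeasure (volume.restrict (Set.Icc (0 : ℝ) 1)) :=
  ⟨by simp⟩

/-- The sequence with first term `u`, followed by `ω`. -/
def consSeq (u : ℝ) (ω : ℕ → ℝ) : ℕ → ℝ := fun n => Nat.casesOn n u ω

theorem measurable_consSeq : Measurable fun p : (ℕ → ℝ) × ℝ => consSeq p.2 p.1 := by
  refine measurable_pi_iff.2 fun n => ?_
  cases n with
  | zero => exact measurable_snd
  | succ n => exact (measurable_pi_apply n).comp measurable_fst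

/-- Putting an independent term in front of an i.i.d. sequence does not change its law. -/
theorem map_consSeq_infinitePi (μ : Measure ℝ) [IsProbabilityMeasure μ] :
    ((Measure.infinitePi fun _ : ℕ => μ).prod μ).map (fun p => consSeq p.2 p.1) =
      Measure.infinitePi fun _ : ℕ => μ := by
  refine Measure.eq_infinitePi _ fun s t ht => ?_
  rw [Measure.map_apply measurable_consSeq
    (MeasurableSet.pi s.countable_toSet fun i _ => ht i)]
  -- the terms other than the first are indexed by the predecessors
  set s' : Finset ℕ := s.preimage Nat.succ Nat.succ_injective.injOn with hs'
  set t0 : Set ℝ := if 0 ∈ s then t 0 else Set.univ with ht0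
  have e : (fun p : (ℕ → ℝ) × ℝ => consSeq p.2 p.1) ⁻¹' (Set.pi s t) =
      (Set.pi s' fun i => t (i + 1)) ×ˢ t0 := by
    ext ⟨ω, u⟩
    simp only [Set.mem_preimage, Set.mem_pi, Set.mem_prod, Finset.mem_coe, hs',
      Finset.mem_preimage]
    constructor
    · intro h
      refine ⟨fun i hi => h (i + 1) hi, ?_⟩
      rw [ht0]
      split_ifs with h0
      · exact h 0 h0
      · trivial
    · rintro ⟨h1, h2⟩ i hi
      cases i with
      | zero => rw [ht0, if_pos hi] at h2; exact h2
      | succ i => exact h1 i hi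
  rw [e, Measure.prod_prod, Measure.infinitePi_pi _ fun i _ => ht (i + 1)]
  have e2 : ∏ i ∈ s', μ (t (i + 1)) = ∏ i ∈ s.erase 0, μ (t i) := by
    refine Finset.prod_bij (fun i _ => i + 1) ?_ ?_ ?_ ?_
    · intro i hi
      rw [hs', Finset.mem_preimage] at hi
      exact Finset.mem_erase.2 ⟨Nat.succ_ne_zero i, hi⟩
    · intro i _ j _ h
      omega
    · intro i hi
      rw [Finset.mem_erase] at hi
      refine ⟨i - 1, Finset.mem_preimage.2 ?_, by omega⟩
      rw [Nat.succ_eq_add_one, Nat.sub_add_cancel (by omega)]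
      exact hi.2
    · intro i _
      rfl
  rw [e2, ht0]
  split_ifs with h0
  · rw [mul_comm, Finset.mul_prod_erase s (fun i => μ (t i)) h0]
  · rw [measure_univ, mul_one, Finset.erase_eq_of_notMem h0]

/-- The factor `√u`, with `u` truncated to `[0, 1]`. -/
noncomputable def sqrtFactor (u : ℝ) : ℝ := √(max 0 (min u 1))

theorem sqrtFactor_mem_Icc (u : ℝ) : sqrtFactor u ∈ Set.Icc (0 : ℝ) 1 :=
  ⟨Real.sqrt_nonneg _, Real.sqrt_le_one.2 (max_le zero_le_one (min_le_right _ _))⟩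

theorem sqrtFactor_of_mem {u : ℝ} (hu : u ∈ Set.Icc (0 : ℝ) 1) : sqrtFactor u = √u := by
  rw [sqrtFactor, min_eq_left hu.2, max_eq_right hu.1]

/-- The terms of the perpetuity `∑ V₀ ⋯ Vₖ (1 - Vₖ)`, where `Vₖ = √(ω k)`. -/
noncomputable def perpetuityTerm (ω : ℕ → ℝ) (k : ℕ) : ℝ :=
  (∏ i ∈ Finset.range k, sqrtFactor (ω i)) * (sqrtFactor (ω k) * (1 - sqrtFactor (ω k)))

/-- The perpetuity `∑ V₀ ⋯ Vₖ (1 - Vₖ)`. -/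
noncomputable def perpetuity (ω : ℕ → ℝ) : ℝ := ∑' k, perpetuityTerm ω k

theorem perpetuityTerm_nonneg (ω : ℕ → ℝ) (k : ℕ) : 0 ≤ perpetuityTerm ω k :=
  mul_nonneg (Finset.prod_nonneg fun _ _ => (sqrtFactor_mem_Icc _).1)
    (mul_nonneg (sqrtFactor_mem_Icc _).1 (sub_nonneg.2 (sqrtFactor_mem_Icc _).2))

theorem sum_perpetuityTerm_le (ω : ℕ → ℝ) (n : ℕ) :
    ∑ k ∈ Finset.range n, perpetuityTerm ω k ≤ 1 := by
  have h : ∀ n, ∑ k ∈ Finset.range n, perpetuityTerm ω k ≤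
      1 - ∏ i ∈ Finset.range n, sqrtFactor (ω i) := by
    intro n
    induction n with
    | zero => simp
    | succ n ih =>
      rw [Finset.sum_range_succ, Finset.prod_range_succ, perpetuityTerm]
      have h1 := sqrtFactor_mem_Icc (ω n)
      have h2 : 0 ≤ ∏ i ∈ Finset.range n, sqrtFactor (ω i) :=
        Finset.prod_nonneg fun _ _ => (sqrtFactor_mem_Icc _).1
      nlinarith [mul_nonneg h2 (sq_nonneg (1 - sqrtFactor (ω n)))]
  have := h n
  have h2 : 0 ≤ ∏ i ∈ Finset.range n, sqrtFactor (ω i) :=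
    Finset.prod_nonneg fun _ _ => (sqrtFactor_mem_Icc _).1
  linarith

theorem summable_perpetuityTerm (ω : ℕ → ℝ) : Summable (perpetuityTerm ω) :=
  summable_of_sum_range_le (perpetuityTerm_nonneg ω) (sum_perpetuityTerm_le ω)

theorem perpetuity_mem_Icc (ω : ℕ → ℝ) : perpetuity ω ∈ Set.Icc (0 : ℝ) 1 :=
  ⟨tsum_nonneg (perpetuityTerm_nonneg ω),
    Real.tsum_le_of_sum_range_le (perpetuityTerm_nonneg ω) (sum_perpetuityTerm_le ω)⟩

theorem perpetuity_consSeq (u : ℝ) (ω : ℕ → ℝ) :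
    perpetuity (consSeq u ω) =
      sqrtFactor u * perpetuity ω + sqrtFactor u * (1 - sqrtFactor u) := by
  have e : ∀ k, perpetuityTerm (consSeq u ω) (k + 1) = sqrtFactor u * perpetuityTerm ω k := by
    intro k
    rw [perpetuityTerm, Finset.prod_range_succ', perpetuityTerm]
    change (∏ i ∈ Finset.range k, sqrtFactor (ω i)) * sqrtFactor u *
      (sqrtFactor (ω k) * (1 - sqrtFactor (ω k))) = _
    ring
  rw [perpetuity, (summable_perpetuityTerm _).tsum_eq_zero_add, add_comm]
  simp only [e]
  rw [tsum_mul_left]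
  congr 1
  simp [perpetuityTerm, consSeq]

theorem measurable_perpetuity : Measurable perpetuity := by
  have hf : Measurable sqrtFactor := by
    unfold sqrtFactor
    fun_prop
  have ht : ∀ k, Measurable fun ω => perpetuityTerm ω k := fun k => by
    unfold perpetuityTerm
    fun_prop
  refine measurable_of_tendsto_metrizable
    (f := fun n ω => ∑ k ∈ Finset.range n, perpetuityTerm ω k) (fun n => ?_) ?_
  · exact Finset.measurable_sum _ fun k _ => ht k
  · exact tendsto_pi_nhds.2 fun ω => (summable_perpetuityTerm ω).hasSum.tendsto_sum_nat

theorem exists_isRDESolution :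
    ∃ ν : ProbabilityMeasure ℝ, IsRDESolution (ν : Measure ℝ) ∧
      ∀ᵐ x ∂(ν : Measure ℝ), x ∈ Set.Icc (0 : ℝ) 1 := by
  set μ : Measure ℝ := volume.restrict (Set.Icc (0 : ℝ) 1) with hμ
  set P := Measure.infinitePi fun _ : ℕ => μ with hP
  refine ⟨⟨P.map perpetuity, Measure.isProbabilityMeasure_map measurable_perpetuity.aemeasurable⟩,
    ?_, ?_⟩
  · change ((P.map perpetuity).prod μ).map
      (fun p : ℝ × ℝ => √p.2 * p.1 + √p.2 * (1 - √p.2)) = P.map perpetuity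
    have e : (P.map perpetuity).prod μ = (P.prod μ).map (Prod.map perpetuity id) := by
      rw [← Measure.map_prod_map P μ measurable_perpetuity measurable_id, Measure.map_id]
    have hm : Measurable fun p : ℝ × ℝ => √p.2 * p.1 + √p.2 * (1 - √p.2) := by fun_prop
    rw [e, Measure.map_map hm (measurable_perpetuity.prodMap measurable_id)]
    conv_rhs => rw [hP, ← map_consSeq_infinitePi μ,
      Measure.map_map measurable_perpetuity measurable_consSeq]
    refine Measure.map_congr ?_
    have hae : ∀ᵐ p : (ℕ → ℝ) × ℝ ∂(P.prod μ), p.2 ∈ Set.Icc (0 : ℝ) 1 :=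
      Measure.quasiMeasurePreserving_snd.ae (ae_restrict_mem measurableSet_Icc)
    filter_upwards [hae] with p hp
    simp only [Function.comp_apply, Prod.map_fst, Prod.map_snd, id]
    rw [perpetuity_consSeq, sqrtFactor_of_mem hp]
  · change ∀ᵐ x ∂(P.map perpetuity), x ∈ Set.Icc (0 : ℝ) 1
    exact (ae_map_iff (p := fun x => x ∈ Set.Icc (0 : ℝ) 1) measurable_perpetuity.aemeasurable
      measurableSet_Icc).2 (ae_of_all _ perpetuity_mem_Icc)

/-! ### Uniqueness of the solution -/

theorem IsRDESolution.charFun_eq {ν : Measure ℝ} [IsProbabilityMeasure ν] (hR : IsRDESolution ν)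
    (t : ℝ) :
    charFun ν t = ∫ u in (0 : ℝ)..1,
      Complex.exp (t * (√u * (1 - √u) : ℝ) * Complex.I) * charFun ν (√u * t) := by
  have hm : Measurable fun p : ℝ × ℝ => √p.2 * p.1 + √p.2 * (1 - √p.2) := by fun_prop
  have hc : Continuous fun x : ℝ => Complex.exp (t * x * Complex.I) := by fun_prop
  have hi : Integrable (fun p : ℝ × ℝ =>
      Complex.exp (t * (√p.2 * p.1 + √p.2 * (1 - √p.2) : ℝ) * Complex.I))
      (ν.prod (volume.restrict (Set.Icc (0 : ℝ) 1))) := by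
    refine Integrable.of_bound (C := 1) (hc.measurable.comp hm).aestronglyMeasurable
      (ae_of_all _ fun p => ?_)
    rw [← Complex.ofReal_mul, Complex.norm_exp_ofReal_mul_I]
  rw [charFun_apply_real]
  conv_lhs => rw [← show _ = ν from hR]
  rw [integral_map hm.aemeasurable hc.aestronglyMeasurable, integral_prod_symm _ hi,
    intervalIntegral.integral_of_le zero_le_one, integral_Icc_eq_integral_Ioc]
  refine integral_congr_ae (ae_of_all _ fun u => ?_)
  simp only
  rw [charFun_apply_real, ← integral_const_mul]
  refine integral_congr_ae (ae_of_all _ fun x => ?_)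
  simp only
  rw [← Complex.exp_add]
  congr 1
  push_cast
  ring

/-- The difference of the characteristic functions is dominated by its own averages over the
points `√u t`; at a point where it is largest on the segment from `0` to `t` this forces it to
be `0`, its value at the origin. No moments are needed. -/
theorem IsRDESolution.unique {ν ν' : Measure ℝ} [IsProbabilityMeasure ν] [IsProbabilityMeasure ν']
    (hR : IsRDESolution ν) (hR' : IsRDESolution ν') : ν = ν' := by
  refine Measure.ext_of_charFun (funext fun t => ?_)
  set f : ℝ → ℝ := fun s => ‖charFun ν s - charFun ν' s‖ with hf
  have hcν := continuous_charFun (μ := ν)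
  have hcν' := continuous_charFun (μ := ν')
  have hfc : Continuous f := (hcν.sub hcν').norm
  have hf0 : f 0 = 0 := by simp [hf]
  have hle : ∀ s, f s ≤ ∫ u in (0 : ℝ)..1, f (√u * s) := by
    intro s
    have hcont : ∀ φ : ℝ → ℂ, Continuous φ → IntervalIntegrable (fun u : ℝ =>
        Complex.exp (s * (√u * (1 - √u) : ℝ) * Complex.I) * φ (√u * s)) volume 0 1 :=
      fun φ hφ => Continuous.intervalIntegrable (by fun_prop) _ _
    simp only [hf]
    rw [hR.charFun_eq, hR'.charFun_eq, ← intervalIntegral.integral_sub (hcont _ hcν) (hcont _ hcν')]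
    refine (intervalIntegral.norm_integral_le_integral_norm zero_le_one).trans (le_of_eq ?_)
    refine intervalIntegral.integral_congr fun u _ => ?_
    rw [← mul_sub, norm_mul, ← Complex.ofReal_mul, Complex.norm_exp_ofReal_mul_I, one_mul]
  obtain ⟨v, hv, hmax⟩ := isCompact_Icc.exists_isMaxOn (Set.nonempty_Icc.2 zero_le_one)
    (f := fun v : ℝ => f (v * t)) (s := Set.Icc (0 : ℝ) 1)
    (hfc.comp (by fun_prop)).continuousOn
  have hM : f (v * t) = 0 := by
    by_contra hne
    have hpos : 0 < f (v * t) := lt_of_le_of_ne (norm_nonneg _) (Ne.symm hne)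
    have hlt : ∫ u in (0 : ℝ)..1, f (√u * (v * t)) < ∫ _ in (0 : ℝ)..1, f (v * t) := by
      refine intervalIntegral.integral_lt_integral_of_continuousOn_of_le_of_exists_lt zero_lt_one
        (hfc.comp (by fun_prop)).continuousOn continuousOn_const (fun u hu => ?_)
        ⟨0, Set.left_mem_Icc.2 zero_le_one, by simpa [hf0] using hpos⟩
      have h1 : √u ≤ 1 := Real.sqrt_le_one.2 hu.2
      have : √u * v ∈ Set.Icc (0 : ℝ) 1 :=
        ⟨mul_nonneg (Real.sqrt_nonneg _) hv.1, mul_le_one₀ h1 hv.1 hv.2⟩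
      rw [← mul_assoc]
      exact hmax this
    have := hle (v * t)
    simp at hlt
    linarith
  have h1 : f t ≤ f (v * t) := by
    simpa using hmax (Set.right_mem_Icc.2 (zero_le_one (α := ℝ)))
  have h2 : ‖charFun ν t - charFun ν' t‖ = 0 := le_antisymm (h1.trans hM.le) (norm_nonneg _)
  exact sub_eq_zero.1 (norm_eq_zero.1 h2)

/-! ### The moments of the solution -/

theorem integral_sqrt_zero_one : ∫ u in (0 : ℝ)..1, √u = 2 / 3 := by
  simp only [Real.sqrt_eq_rpow]
  rw [integral_rpow (Or.inl (by norm_num))]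
  norm_num

theorem integral_mul_sqrt_zero_one : ∫ u in (0 : ℝ)..1, u * √u = 2 / 5 := by
  have : ∫ u in (0 : ℝ)..1, u * √u = ∫ u in (0 : ℝ)..1, u ^ (3 / 2 : ℝ) := by
    refine intervalIntegral.integral_congr fun u hu => ?_
    rw [Set.uIcc_of_le zero_le_one] at hu
    simp only [Real.sqrt_eq_rpow]
    rw [show (3 / 2 : ℝ) = 1 + 1 / 2 by norm_num, Real.rpow_add_of_nonneg hu.1 (by norm_num)
      (by norm_num), Real.rpow_one]
  rw [this, integral_rpow (Or.inl (by norm_num))]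
  norm_num

section Moments

variable {ν : Measure ℝ} [IsProbabilityMeasure ν]

theorem IsRDESolution.integral_id (h01 : ∀ᵐ x ∂ν, x ∈ Set.Icc (0 : ℝ) 1) (hR : IsRDESolution ν) :
    ∫ x, x ∂ν = 1 / 2 := by
  have hi : Integrable (fun x : ℝ => x) ν := integrable_of_continuous_of_mem_Icc h01 continuous_id
  have h := hR.integral_eq h01 (f := fun x => x) continuous_id
  have e : ∫ u in (0 : ℝ)..1, ∫ x, (√u * (1 - √u) + √u * x) ∂ν =
      ∫ u in (0 : ℝ)..1, (√u - u + √u * ∫ x, x ∂ν) := by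
    refine intervalIntegral.integral_congr fun u hu => ?_
    rw [Set.uIcc_of_le zero_le_one] at hu
    rw [integral_add (integrable_const _) (hi.const_mul _), integral_const, integral_const_mul]
    have := Real.mul_self_sqrt hu.1
    simp only [probReal_univ, one_smul]
    linarith
  rw [e, intervalIntegral.integral_add (Continuous.intervalIntegrable (by fun_prop) _ _)
    (Continuous.intervalIntegrable (by fun_prop) _ _),
    intervalIntegral.integral_sub (Continuous.intervalIntegrable (by fun_prop) _ _)
    (Continuous.intervalIntegrable (by fun_prop) _ _), intervalIntegral.integral_mul_const,
    integral_sqrt_zero_one, _root_.integral_id] at h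
  linarith

theorem IsRDESolution.integral_sq (h01 : ∀ᵐ x ∂ν, x ∈ Set.Icc (0 : ℝ) 1) (hR : IsRDESolution ν) :
    ∫ x, x ^ 2 ∂ν = 4 / 15 := by
  have hi : Integrable (fun x : ℝ => x) ν := integrable_of_continuous_of_mem_Icc h01 continuous_id
  have hi2 : Integrable (fun x : ℝ => x ^ 2) ν :=
    integrable_of_continuous_of_mem_Icc h01 (by fun_prop)
  have h1 := hR.integral_id h01
  have h := hR.integral_eq h01 (f := fun x => x ^ 2) (by fun_prop)
  have e : ∫ u in (0 : ℝ)..1, ∫ x, (√u * (1 - √u) + √u * x) ^ 2 ∂ν =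
      ∫ u in (0 : ℝ)..1, (u * (2 + ∫ x, x ^ 2 ∂ν) + u ^ 2 - 3 * (u * √u)) := by
    refine intervalIntegral.integral_congr fun u hu => ?_
    rw [Set.uIcc_of_le zero_le_one] at hu
    have hs := Real.sq_sqrt hu.1
    have e1 : ∀ x : ℝ, (√u * (1 - √u) + √u * x) ^ 2 =
        (u - 2 * (u * √u) + u ^ 2) + (2 * u - 2 * (u * √u)) * x + u * x ^ 2 := by
      intro x
      have : (√u * (1 - √u) + √u * x) ^ 2 = √u ^ 2 - 2 * (√u ^ 2 * √u) + (√u ^ 2) ^ 2 +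
        (2 * √u ^ 2 - 2 * (√u ^ 2 * √u)) * x + √u ^ 2 * x ^ 2 := by ring
      rw [this, hs]
    simp only [e1]
    have hi1 : Integrable (fun x : ℝ =>
        u - 2 * (u * √u) + u ^ 2 + (2 * u - 2 * (u * √u)) * x) ν :=
      (integrable_const _).add (hi.const_mul _)
    rw [integral_add hi1 (hi2.const_mul _),
      integral_add (integrable_const _) (hi.const_mul _), integral_const, integral_const_mul,
      integral_const_mul, h1]
    simp only [probReal_univ, one_smul]
    ring
  rw [e, intervalIntegral.integral_sub (Continuous.intervalIntegrable (by fun_prop) _ _)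
    (Continuous.intervalIntegrable (by fun_prop) _ _),
    intervalIntegral.integral_add (Continuous.intervalIntegrable (by fun_prop) _ _)
    (Continuous.intervalIntegrable (by fun_prop) _ _), intervalIntegral.integral_mul_const,
    intervalIntegral.integral_const_mul, integral_mul_sqrt_zero_one, _root_.integral_id,
    integral_pow] at h
  norm_num at h
  linarith

end Moments

/-! ### Uniformly random permutations -/

theorem permArray_bijOn {n : ℕ} (σ : Equiv.Perm (Fin n)) :
    Set.BijOn (permArray σ) (Set.Iio n) (Set.Ico 0 (0 + n)) := by
  refine ⟨fun k hk => ?_, fun k hk l hl h => ?_, fun v hv => ?_⟩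
  · simp only [Set.mem_Iio] at hk
    simp [permArray, hk]
  · simp only [Set.mem_Iio] at hk hl
    simp only [permArray, hk, hl, dif_pos] at h
    simpa using σ.injective (Fin.ext h)
  · have hv' : v < n := by simpa using hv.2
    exact ⟨σ.symm ⟨v, hv'⟩, (σ.symm ⟨v, hv'⟩).2, by simp [permArray]⟩

theorem isMinExchangeable_permArray (n : ℕ) :
    IsMinExchangeable (fun _ : Equiv.Perm (Fin n) => (1 : ℝ)) permArray n 0 where
  nonneg _ := zero_le_one
  bijOn σ _ := permArray_bijOn σ
  invariant π hπ F := by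
    have h0 : π 0 = 0 := hπ 0 (by simp)
    have hfix : ∀ v, n ≤ v → π v = v := fun v hv => hπ v (by simp [hv])
    have h1 : ∀ v < n, π v < n := fun v hv => by
      by_contra hc
      have := π.injective (hfix (π v) (by omega))
      omega
    have h2 : ∀ v < n, π.symm v < n := fun v hv => by
      by_contra hc
      have := hfix (π.symm v) (by omega)
      rw [Equiv.apply_symm_apply] at this
      omega
    let π' : Equiv.Perm (Fin n) :=
      ⟨fun i => ⟨π i, h1 i i.2⟩, fun i => ⟨π.symm i, h2 i i.2⟩, fun i => by simp,
        fun i => by simp⟩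
    have e : ∀ σ : Equiv.Perm (Fin n), π ∘ permArray σ = permArray (π' * σ) := by
      intro σ
      funext k
      by_cases hk : k < n
      · simp [permArray, hk, π']
      · simp [permArray, hk, h0]
    simp only [e, one_mul]
    exact Equiv.sum_comp (Equiv.mulLeft π') fun σ => F (permArray σ)

instance discreteMeasurableSpace_perm (n : ℕ) : DiscreteMeasurableSpace (Equiv.Perm (Fin n)) :=
  ⟨fun _ => trivial⟩

theorem integral_selectMeasure {n : ℕ} (hn : 1 ≤ n) (F : ℕ → ℝ) :
    ∫ ω, F (keyExchanges n ω) ∂(selectMeasure n) =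
      (∑ σ : Equiv.Perm (Fin n), ∑ r ∈ Finset.range n,
        F (quickselectExchanges (permArray σ) n (r + 1))) / (n.factorial * n) := by
  obtain ⟨n, rfl⟩ : ∃ m, n = m + 1 := ⟨n - 1, by omega⟩
  rw [integral_fintype (Integrable.of_finite)]
  have hs : ∀ ω : Equiv.Perm (Fin (n + 1)) × Fin (n + 1),
      (selectMeasure (n + 1)).real {ω} = 1 / ((n + 1).factorial * (n + 1 : ℕ)) := by
    rintro ⟨σ, r⟩
    rw [measureReal_def, selectMeasure, ← Set.singleton_prod_singleton, Measure.prod_prod,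
      uniformOn_univ, uniformOn_univ, Measure.count_singleton, Measure.count_singleton,
      Fintype.card_perm, Fintype.card_fin, ENNReal.toReal_mul, ENNReal.toReal_div,
      ENNReal.toReal_div]
    simp only [ENNReal.toReal_one, ENNReal.toReal_natCast]
    rw [one_div_mul_one_div]
  simp only [hs, smul_eq_mul]
  rw [← Finset.mul_sum, Fintype.sum_prod_type, one_div, mul_comm, ← div_eq_mul_inv]
  congr 1
  refine Finset.sum_congr rfl fun σ _ => ?_
  exact Fin.sum_univ_eq_sum_range
    (fun r => F (quickselectExchanges (permArray σ) (n + 1) (r + 1))) (n + 1)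

theorem keyExchanges_le (n : ℕ) (ω : Equiv.Perm (Fin n) × Fin n) : keyExchanges n ω ≤ n :=
  quickselectExchanges_le (permArray_bijOn ω.1) _

section Convergence

variable {ν : Measure ℝ} [IsProbabilityMeasure ν]

/-- The law of `keyExchanges n` is within Wasserstein distance `O(√n)` of the law of `n X`. -/
theorem abs_integral_keyExchanges_sub_le (h01 : ∀ᵐ x ∂ν, x ∈ Set.Icc (0 : ℝ) 1)
    (hR : IsRDESolution ν) {n : ℕ} (hn : 1 ≤ n) {g : ℝ → ℝ} (hg : LipschitzWith 1 g) :
    |∫ ω, g (keyExchanges n ω) ∂(selectMeasure n) - ∫ x, g (n * x) ∂ν| ≤ 60 * √n + 4 := by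
  have h := IsMinExchangeable.distanceBound (Ω := Equiv.Perm (Fin n)) h01 hR hn _ _ _
    (isMinExchangeable_permArray n) g hg
  have h1 := (isMinExchangeable_permArray n).sum_ite_le fun σ => permArray σ 0 = 0
  have hc : ∑ _σ : Equiv.Perm (Fin n), (1 : ℝ) = n.factorial := by
    simp [Fintype.card_perm]
  have hn' : (0 : ℝ) < n := by exact_mod_cast hn
  have hf : (0 : ℝ) < n.factorial := by exact_mod_cast n.factorial_pos
  simp only [one_mul, hc] at h h1
  rw [integral_selectMeasure hn fun y => g y, div_sub' (by positivity), abs_div,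
    abs_of_pos (by positivity : (0 : ℝ) < n.factorial * n), div_le_iff₀ (by positivity)]
  rw [Finset.sum_sub_distrib, Finset.sum_const, Finset.card_univ, Fintype.card_perm,
    Fintype.card_fin, nsmul_eq_mul, ← mul_assoc] at h
  refine h.trans ?_
  have := mul_le_mul_of_nonneg_left h1 hn'.le
  linarith

theorem tendsto_integral_keyExchanges (h01 : ∀ᵐ x ∂ν, x ∈ Set.Icc (0 : ℝ) 1)
    (hR : IsRDESolution ν) {f : ℝ → ℝ} {L : NNReal} (hf : LipschitzWith L f) :
    Tendsto (fun n : ℕ => ∫ ω, f (keyExchanges n ω / n) ∂(selectMeasure n)) atTop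
      (𝓝 (∫ x, f x ∂ν)) := by
  -- `L` itself may be zero
  set K : ℝ := L + 1 with hK
  have hK0 : 0 < K := by positivity
  have hlim : Tendsto (fun n : ℕ => K * (64 / √(n : ℝ))) atTop (𝓝 0) := by
    rw [← mul_zero K]
    exact ((tendsto_const_nhds.div_atTop
      (Real.tendsto_sqrt_atTop.comp tendsto_natCast_atTop_atTop))).const_mul K
  rw [tendsto_iff_dist_tendsto_zero]
  refine squeeze_zero' (Eventually.of_forall fun _ => dist_nonneg) ?_ hlim
  filter_upwards [eventually_ge_atTop 1] with n hn
  have hn' : (0 : ℝ) < n := by exact_mod_cast hn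
  have hg : LipschitzWith 1 fun y => n / K * f (y / n) := by
    refine LipschitzWith.of_dist_le_mul fun x y => ?_
    rw [Real.dist_eq, ← mul_sub, abs_mul, abs_of_pos (by positivity), NNReal.coe_one, one_mul]
    have h1 : |f (x / n) - f (y / n)| ≤ K * (dist x y / n) := by
      have := hf.dist_le_mul (x / n) (y / n)
      rw [Real.dist_eq, Real.dist_eq, ← sub_div, abs_div, abs_of_pos hn', ← Real.dist_eq x] at this
      refine this.trans (mul_le_mul_of_nonneg_right (by linarith) (by positivity))
    calc n / K * |f (x / n) - f (y / n)| ≤ n / K * (K * (dist x y / n)) := by gcongr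
      _ = dist x y := by field_simp
  have h := abs_integral_keyExchanges_sub_le h01 hR hn hg
  simp only [mul_div_cancel_left₀ _ hn'.ne'] at h
  rw [integral_const_mul, integral_const_mul, ← mul_sub, abs_mul,
    abs_of_pos (by positivity : 0 < n / K)] at h
  rw [Real.dist_eq]
  have hs1 : 1 ≤ √(n : ℝ) := Real.one_le_sqrt.2 (by exact_mod_cast hn)
  have hsq : √(n : ℝ) * √n = n := Real.mul_self_sqrt hn'.le
  generalize |∫ ω, f (keyExchanges n ω / n) ∂(selectMeasure n) - ∫ x, f x ∂ν| = D at h ⊢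
  have h2 : n * D ≤ K * (64 * √n) := by
    have : n / K * D = n * D / K := by ring
    rw [this, div_le_iff₀ hK0] at h
    refine h.trans ?_
    rw [mul_comm K]
    gcongr
    linarith
  rw [mul_div_assoc', le_div_iff₀ (by positivity)]
  have hs0 : 0 < √(n : ℝ) := by positivity
  refine le_of_mul_le_mul_right ?_ hs0
  calc D * √n * √n = n * D := by rw [mul_assoc, hsq, mul_comm]
    _ ≤ K * (64 * √n) := h2
    _ = K * 64 * √n := by ring

/-- The square truncated to `[0, 1]`, a Lipschitz test function that agrees with the square on the
range of `keyExchanges n / n`. -/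
theorem lipschitzWith_sq_clamp : LipschitzWith 2 fun x : ℝ => (max 0 (min x 1)) ^ 2 := by
  have h : LipschitzWith 1 fun x : ℝ => max 0 (min x 1) :=
    (LipschitzWith.id.min_const 1).const_max 0
  refine LipschitzWith.of_dist_le_mul fun x y => ?_
  have h1 := h.dist_le_mul x y
  rw [NNReal.coe_one, one_mul, Real.dist_eq] at h1
  have hx : 0 ≤ max 0 (min x 1) ∧ max 0 (min x 1) ≤ 1 :=
    ⟨le_max_left _ _, max_le zero_le_one (min_le_right _ _)⟩
  have hy : 0 ≤ max 0 (min y 1) ∧ max 0 (min y 1) ≤ 1 :=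
    ⟨le_max_left _ _, max_le zero_le_one (min_le_right _ _)⟩
  rw [Real.dist_eq, sq_sub_sq, abs_mul, abs_of_nonneg (by linarith : 0 ≤ max 0 (min x 1) +
    max 0 (min y 1)), NNReal.coe_ofNat]
  exact mul_le_mul (by linarith) h1 (abs_nonneg _) (by norm_num)

theorem clamp_sq_of_mem {x : ℝ} (hx : x ∈ Set.Icc (0 : ℝ) 1) : (max 0 (min x 1)) ^ 2 = x ^ 2 := by
  rw [min_eq_left hx.2, max_eq_right hx.1]

theorem tendsto_variance_keyExchanges (h01 : ∀ᵐ x ∂ν, x ∈ Set.Icc (0 : ℝ) 1)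
    (hR : IsRDESolution ν) :
    Tendsto (fun n : ℕ => variance (fun ω => (keyExchanges n ω : ℝ)) (selectMeasure n) / n ^ 2)
      atTop (𝓝 (1 / 60)) := by
  have h1 := tendsto_integral_keyExchanges h01 hR (LipschitzWith.id (α := ℝ))
  have h2 := tendsto_integral_keyExchanges h01 hR lipschitzWith_sq_clamp
  have e2 : ∫ x, (max 0 (min x 1)) ^ 2 ∂ν = ∫ x, x ^ 2 ∂ν :=
    integral_congr_ae (h01.mono fun x hx => clamp_sq_of_mem hx)
  simp only [id] at h1
  rw [hR.integral_id h01] at h1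
  rw [e2, hR.integral_sq h01] at h2
  have h3 := h2.sub (h1.pow 2)
  rw [show (4 / 15 : ℝ) - (1 / 2) ^ 2 = 1 / 60 by norm_num] at h3
  refine h3.congr' ?_
  filter_upwards [eventually_ge_atTop 1] with n hn
  have hn' : (0 : ℝ) < n := by exact_mod_cast hn
  obtain ⟨m, rfl⟩ : ∃ m, n = m + 1 := ⟨n - 1, by omega⟩
  have hmem : MemLp (fun ω => (keyExchanges (m + 1) ω : ℝ)) 2 (selectMeasure (m + 1)) :=
    MemLp.of_bound (measurable_of_countable _).aestronglyMeasurable ((m + 1 : ℕ) : ℝ)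
      (ae_of_all _ fun ω => by
        rw [Real.norm_natCast]
        exact_mod_cast keyExchanges_le _ ω)
  rw [variance_eq_sub hmem, sub_div]
  congr 1
  · rw [← integral_div]
    refine integral_congr_ae (ae_of_all _ fun ω => ?_)
    simp only [Pi.pow_apply]
    rw [clamp_sq_of_mem, div_pow]
    have : (keyExchanges (m + 1) ω : ℝ) ≤ (m + 1 : ℕ) := by exact_mod_cast keyExchanges_le _ ω
    exact ⟨by positivity, (div_le_one hn').2 this⟩
  · rw [← div_pow, ← integral_div]

end Convergence

theorem theorem1 :
    ∃ ν : ProbabilityMeasure ℝ,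
      (IsRDESolution (ν : Measure ℝ) ∧
        ∀ ν' : ProbabilityMeasure ℝ, IsRDESolution (ν' : Measure ℝ) → ν' = ν) ∧
      TendstoInDistribution
        (fun (n : ℕ) (ω : Equiv.Perm (Fin (n + 1)) × Fin (n + 1)) =>
          (keyExchanges (n + 1) ω : ℝ) / ((n + 1 : ℕ) : ℝ))
        atTop (id : ℝ → ℝ) (fun n => selectMeasure (n + 1)) (ν : Measure ℝ) ∧
      Asymptotics.IsEquivalent atTop
        (fun n : ℕ => variance (fun ω => (keyExchanges n ω : ℝ)) (selectMeasure n))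
        (fun n : ℕ => (1 / 60 : ℝ) * (n : ℝ) ^ 2) := by
  obtain ⟨ν, hR, h01⟩ := exists_isRDESolution
  have hunique : ∀ ν' : ProbabilityMeasure ℝ, IsRDESolution (ν' : Measure ℝ) → ν' = ν := by
    intro ν' hR'
    have h : (ν' : Measure ℝ) = ν := hR'.unique hR
    exact Subtype.ext h
  refine ⟨ν, ⟨hR, hunique⟩, ?_, ?_⟩
  · have hmeas : ∀ n : ℕ, AEMeasurable (fun ω : Equiv.Perm (Fin (n + 1)) × Fin (n + 1) =>
        (keyExchanges (n + 1) ω : ℝ) / ((n + 1 : ℕ) : ℝ)) (selectMeasure (n + 1)) :=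
      fun n => (measurable_of_countable _).aemeasurable
    refine ⟨hmeas, aemeasurable_id, ?_⟩
    refine tendsto_iff_forall_lipschitz_integral_tendsto.2 ?_
    rintro f - ⟨L, hf⟩
    have h := (tendsto_integral_keyExchanges h01 hR hf).comp (tendsto_add_atTop_nat 1)
    simp only [ProbabilityMeasure.coe_mk, Measure.map_id]
    refine h.congr fun n => ?_
    exact (integral_map (hmeas n) hf.continuous.aestronglyMeasurable).symm
  · refine Asymptotics.isEquivalent_of_tendsto_one ?_
    have h := (tendsto_variance_keyExchanges h01 hR).mul_const 60
    rw [show (1 / 60 : ℝ) * 60 = 1 by norm_num] at h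
    refine h.congr fun n => ?_
    simp only [Pi.div_apply]
    rw [one_div, div_mul_eq_div_div, div_inv_eq_mul, div_mul_eq_mul_div]
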